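/- Let $n\ge 1$ and let $X_{1},\dots,X_{n}$ be real-valued random variables with mean $0$ on a probability space $(\Omega,\mathcal A,\mathbb P)$; put $S_n=\sum_{i=1}^n X_i$. (All quantities below may depend on $n$.) Let $\Psi:\mathbb N^2\to\mathbb N$ be one of the four functions $$\Psi(u,v)=v,\qquad \Psi(u,v)=u+v,\qquad \Psi(u,v)=uv,\qquad \Psi(u,v)=u+v+uv .$$ Assume that there are constants $K,M,L_1,L_2>0$, $a,b\ge 0$ and a nonincreasing sequence of real numbers $(\rho(s))_{s\ge 0}$ such that the following hold. (i) For all integers $u,v\ge 1$ and all tuples $(s_1,\dots,s_u)$, $(t_1,\dots,t_v)$ of integers with $1\le s_1\le\cdots\le s_u\le t_1\le\cdots\le t_v\le n$, $$\Bigl|\mathrm{Cov}\Bigl(\prod_{i=1}^u X_{s_i},\prod_{j=1}^v X_{t_j}\Bigr)\Bigr|\le K^2M^{u+v}\{(u+v)!\}^{b}\,\Psi(u,v)\,\rho(t_1-s_u).$$ (ii) For every integer $k\ge 0$ the series $\sum_{s=0}^\infty (s+1)^k\rho(s)$ converges and $$\sum_{s=0}^\infty (s+1)^k\rho(s)\le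 L_1L_2^k(k!)^{a}.$$ (iii) For every $i=1,\dots,n$ and every integer $k\ge 0$, $\mathbb E|X_i|^k\le (k!)^{b}M^k$ (in particular all moments are finite). Then, for every $x>0$, $$\mathbb P(S_n\ge x)\le \exp\Bigl\{-\frac{x^2}{C_1 n+C_2\,x^{(2a+2b+3)/(a+b+2)}}\Bigr\},$$ where $$C_1=2^{a+b+3}K^2M^2L_1(K^2\vee 2),\qquad C_2=2\{ML_2(K^2\vee 2)\}^{1/(a+b+2)} .$$ -/

import Mathlib

open MeasureTheory ProbabilityTheory
open scoped Nat

/-- The four types of weak dependence (Doukhan and Louhichi). -/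
inductive WeakDependenceType where
  | theta
  | eta
  | kappa
  | lambda

/-- The weight `Ψ : ℕ² → ℕ` attached to each type of weak dependence
(the bound of the corresponding type with both Lipschitz constants removed). -/
def WeakDependenceType.weight : WeakDependenceType → ℕ → ℕ → ℕ
  | .theta, _, v => v
  | .eta, u, v => u + v
  | .kappa, u, v => u * v
  | .lambda, u, v => u + v + u * v

/-- The joint cumulants attached to a family of joint moments `m`, defined by the recursion
`m A = ∑_{min A ∈ B ⊆ A} κ(B) m(A \ B)`. -/
noncomputable def cumul {ι : Type*} [LinearOrder ι] (m : Finset ι → ℝ) (A : Finset ι) : ℝ :=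
  if h : A.Nonempty then
    m A - ∑ C ∈ (A.erase (A.min' h)).ssubsets.attach,
      cumul m (insert (A.min' h) C.1) * m (A.erase (A.min' h) \ C.1)
  else 0
termination_by A.card
decreasing_by
  have hC := Finset.mem_ssubsets.1 C.2
  have h1 := Finset.card_lt_card hC
  have h2 := Finset.card_insert_le (A.min' h) C.1
  have h3 := Finset.card_erase_add_one (A.min'_mem h)
  omega

section Cumulants

variable {ι : Type*} [LinearOrder ι]

theorem cumul_eq (m : Finset ι → ℝ) {A : Finset ι} (h : A.Nonempty) :
    cumul m A = m A - ∑ C ∈ (A.erase (A.min' h)).ssubsets,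
      cumul m (insert (A.min' h) C) * m (A.erase (A.min' h) \ C) := by
  rw [cumul, dif_pos h]
  congr 1
  exact Finset.sum_attach _ (fun C => cumul m (insert (A.min' h) C) * m (A.erase (A.min' h) \ C))

theorem eq_sum_cumul_mul (m : Finset ι → ℝ) (hm : m ∅ = 1) {A : Finset ι} (h : A.Nonempty) :
    m A = ∑ C ∈ (A.erase (A.min' h)).powerset,
      cumul m (insert (A.min' h) C) * m (A.erase (A.min' h) \ C) := by
  have e : (A.erase (A.min' h)).ssubsets = (A.erase (A.min' h)).powerset.erase (A.erase (A.min' h)) := rfl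
  have h1 := cumul_eq m h
  rw [e] at h1
  rw [← Finset.add_sum_erase _ _ (Finset.mem_powerset_self (A.erase (A.min' h)))]
  simp only [Finset.insert_erase (A.min'_mem h), Finset.sdiff_self, hm, mul_one]
  linarith

theorem card_insert_lt_of_ssubset_erase {A C : Finset ι} {a : ι} (ha : a ∈ A)
    (hC : C ⊂ A.erase a) : (insert a C).card < A.card := by
  have h1 := Finset.card_lt_card hC
  have h2 := Finset.card_insert_le a C
  have h3 := Finset.card_erase_add_one ha
  omega

theorem cumul_congr {m m' : Finset ι → ℝ} {A : Finset ι} (h : ∀ B ⊆ A, m B = m' B) :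
    cumul m A = cumul m' A := by
  induction A using Finset.strongInductionOn with
  | _ A ih =>
    rcases A.eq_empty_or_nonempty with rfl | hA
    · simp [cumul]
    rw [cumul_eq m hA, cumul_eq m' hA, h A subset_rfl]
    congr 1
    refine Finset.sum_congr rfl fun C hC => ?_
    have hC := Finset.mem_ssubsets.1 hC
    have hsub : insert (A.min' hA) C ⊆ A :=
      Finset.insert_subset (A.min'_mem hA) (hC.1.trans (Finset.erase_subset _ _))
    have hss : insert (A.min' hA) C ⊂ A := by
      refine hsub.ssubset_of_ne fun e => ?_
      have := card_insert_lt_of_ssubset_erase (A.min'_mem hA) hC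
      rw [e] at this
      exact lt_irrefl _ this
    rw [ih _ hss fun B hB => h B (hB.trans hsub),
      h _ (Finset.sdiff_subset.trans (Finset.erase_subset _ _))]

/-- Joint cumulants vanish on sets that meet two independent groups of variables. -/
theorem cumul_eq_zero_of_factor (m : Finset ι → ℝ) (hm : m ∅ = 1) (U : Set ι) [DecidablePred (· ∈ U)]
    (hf : ∀ A, m A = m (A.filter (· ∈ U)) * m (A.filter (· ∉ U))) (A : Finset ι)
    (h1 : (A.filter (· ∈ U)).Nonempty) (h2 : (A.filter (· ∉ U)).Nonempty) : cumul m A = 0 := by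
  induction A using Finset.strongInductionOn with
  | _ A ih =>
    have hA : A.Nonempty := h1.mono (Finset.filter_subset _ _)
    have key : ∀ (V : Set ι) [DecidablePred (· ∈ V)],
        (∀ A, m A = m (A.filter (· ∈ V)) * m (A.filter (· ∉ V))) →
        (∀ B ⊂ A, (B.filter (· ∈ V)).Nonempty → (B.filter (· ∉ V)).Nonempty → cumul m B = 0) →
        A.min' hA ∈ V → (A.filter (· ∉ V)).Nonempty → cumul m A = 0 := by
      intro V _ hV ihV haV hne
      set a := A.min' hA with ha
      have haA : a ∈ A := A.min'_mem hA
      rw [cumul_eq m hA, ← ha]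
      set A₁ := A.filter (· ∈ V) with hA₁
      have ha₁ : a ∈ A₁ := Finset.mem_filter.2 ⟨haA, haV⟩
      have hne₁ : A₁.Nonempty := ⟨a, ha₁⟩
      have hmin : A₁.min' hne₁ = a :=
        le_antisymm (Finset.min'_le _ _ ha₁)
          (Finset.min'_le _ _ (Finset.filter_subset _ _ (Finset.min'_mem _ _)))
      have hfac := eq_sum_cumul_mul m hm hne₁
      rw [hmin] at hfac
      have hsub : (A₁.erase a).powerset ⊆ (A.erase a).ssubsets := by
        intro C hC
        rw [Finset.mem_powerset] at hC
        rw [Finset.mem_ssubsets]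
        refine ⟨hC.trans (Finset.erase_subset_erase _ (Finset.filter_subset _ _)), fun hc => ?_⟩
        obtain ⟨j, hj⟩ := hne
        rw [Finset.mem_filter] at hj
        have hja : j ≠ a := fun e => hj.2 (e ▸ haV)
        have := hC (hc (Finset.mem_erase.2 ⟨hja, hj.1⟩))
        exact hj.2 (Finset.mem_filter.1 (Finset.mem_of_mem_erase this)).2
      rw [← Finset.sum_subset hsub]
      · have hA2 := hV A
        rw [← hA₁, hfac, Finset.sum_mul] at hA2
        rw [hA2, sub_eq_zero]
        refine Finset.sum_congr rfl fun C hC => ?_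
        rw [Finset.mem_powerset] at hC
        rw [mul_assoc, hV (A.erase a \ C)]
        congr 3
        · ext j
          simp only [hA₁, Finset.mem_filter, Finset.mem_sdiff, Finset.mem_erase]
          tauto
        · ext j
          simp only [Finset.mem_filter, Finset.mem_sdiff, Finset.mem_erase]
          refine ⟨fun h => ⟨⟨⟨fun e => h.2 (e ▸ haV), h.1⟩, fun hjC => ?_⟩, h.2⟩,
            fun h => ⟨h.1.1.2, h.2⟩⟩
          exact h.2 (Finset.mem_filter.1 (Finset.mem_of_mem_erase (hC hjC))).2
      · intro C hC hC'
        rw [Finset.mem_ssubsets] at hC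
        rw [Finset.mem_powerset] at hC'
        have hBss : insert a C ⊂ A := by
          refine (Finset.insert_subset haA (hC.1.trans (Finset.erase_subset _ _))).ssubset_of_ne
            fun e => ?_
          have := card_insert_lt_of_ssubset_erase haA hC
          rw [e] at this
          exact lt_irrefl _ this
        rw [ihV _ hBss ⟨a, by simp [haV]⟩, zero_mul]
        by_contra hcon
        refine hC' fun j hj => ?_
        have hjA := hC.1 hj
        rw [Finset.mem_erase] at hjA ⊢
        refine ⟨hjA.1, Finset.mem_filter.2 ⟨hjA.2, ?_⟩⟩
        by_contra hjV
        exact hcon ⟨j, Finset.mem_filter.2 ⟨Finset.mem_insert_of_mem hj, hjV⟩⟩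
    by_cases haU : A.min' hA ∈ U
    · exact key U hf (fun B hB => ih B hB) haU h2
    · refine key Uᶜ (fun A => ?_) (fun B hB hB1 hB2 => ?_) haU ?_
      · rw [hf A, mul_comm]
        simp
      · simp only [Set.mem_compl_iff, not_not] at hB1 hB2
        exact ih B hB hB2 hB1
      · simpa using h1

end Cumulants

/-- Bound for the normalized joint moments of `k` centred variables. -/
noncomputable def momentWeight (k : ℕ) : ℝ := if k = 1 then 0 else 1

/-- Bound for `Ψ(u, v)` with `u + v = k`. -/
noncomputable def covWeight (k : ℕ) : ℝ := if k ≤ 1 then 0 else k + (k : ℝ) ^ 2 / 4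

/-- Normalized weight in the bound for joint cumulants of order `c + 1`. -/
noncomputable def cumulRate (c : ℕ) : ℝ := if c = 0 then 0 else 2 * (3 / 2) ^ c

theorem momentWeight_nonneg (k : ℕ) : 0 ≤ momentWeight k := by
  unfold momentWeight; split_ifs <;> norm_num

theorem momentWeight_le_one (k : ℕ) : momentWeight k ≤ 1 := by
  unfold momentWeight; split_ifs <;> norm_num

theorem covWeight_nonneg (k : ℕ) : 0 ≤ covWeight k := by
  unfold covWeight; split_ifs <;> positivity

theorem cumulRate_nonneg (k : ℕ) : 0 ≤ cumulRate k := by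
  unfold cumulRate; split_ifs <;> positivity

theorem cumulRate_le (k : ℕ) : cumulRate k ≤ 2 * (3 / 2) ^ k := by
  unfold cumulRate; split_ifs
  · positivity
  · exact le_rfl

theorem sum_choose_mul_factorial_reflect (s : ℕ) (f : ℕ → ℕ → ℝ) :
    ∑ c ∈ Finset.range s, (s.choose c : ℝ) * ((c ! : ℝ) * f c (s - c)) =
      (s ! : ℝ) * ∑ i ∈ Finset.range s, f (s - (i + 1)) (i + 1) / ((i + 1)! : ℝ) := by
  rw [← Finset.sum_range_reflect, Finset.mul_sum]
  refine Finset.sum_congr rfl fun i hi => ?_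
  have hi := Finset.mem_range.1 hi
  have e1 : s - 1 - i = s - (i + 1) := by omega
  have e2 : s - (s - (i + 1)) = i + 1 := by omega
  rw [e1, e2]
  have h := Nat.choose_mul_factorial_mul_factorial (n := s) (k := s - (i + 1)) (by omega)
  rw [e2] at h
  have h' : ((s.choose (s - (i + 1)) : ℝ)) * ((s - (i + 1))! : ℝ) * ((i + 1)! : ℝ) = (s ! : ℝ) := by
    exact_mod_cast h
  rw [← h']
  have : ((i + 1)! : ℝ) ≠ 0 := by positivity
  field_simp

theorem exp_one_le : Real.exp 1 ≤ 2.7182818286 := Real.exp_one_lt_d9.le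

theorem exp_two_thirds_le : Real.exp (2 / 3) ≤ 2 := by
  have h : Real.exp (2 / 3) ^ 3 = Real.exp 1 ^ 2 := by
    rw [← Real.exp_nat_mul, ← Real.exp_nat_mul]; norm_num
  have h1 := exp_one_le
  have h2 := Real.exp_pos 1
  by_contra hc
  push Not at hc
  have : (2 : ℝ) ^ 3 < Real.exp (2 / 3) ^ 3 := by gcongr
  nlinarith

theorem sum_pow_div_factorial_tail_le {x : ℝ} (hx : 0 ≤ x) (s : ℕ) :
    ∑ i ∈ Finset.range s, x ^ (i + 2) / ((i + 2)! : ℝ) ≤ Real.exp x - 1 - x := by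
  have h := Real.sum_le_exp_of_nonneg hx (s + 2)
  rw [Finset.sum_range_succ', Finset.sum_range_succ'] at h
  simp at h
  simp only [add_assoc, one_add_one_eq_two] at h
  linarith

theorem six_le_factorial {s : ℕ} (hs : 3 ≤ s) : (6 : ℝ) ≤ (s ! : ℝ) := by
  have := Nat.factorial_le hs
  norm_num [Nat.factorial] at this
  exact_mod_cast this

theorem momentWeight_sum_le (s : ℕ) :
    momentWeight (s + 1) + ∑ c ∈ Finset.range s,
      (s.choose c : ℝ) * ((c ! : ℝ) * momentWeight (s - c)) ≤ (s ! : ℝ) := by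
  rcases Nat.lt_or_ge s 3 with hs | hs
  · interval_cases s <;> norm_num [momentWeight, Finset.sum_range_succ]
  rw [sum_choose_mul_factorial_reflect s (fun _ i => momentWeight i)]
  have h0 := momentWeight_le_one (s + 1)
  have h1 : ∑ i ∈ Finset.range s, momentWeight (i + 1) / ((i + 1)! : ℝ) ≤ Real.exp 1 - 1 - 1 := by
    obtain ⟨s, rfl⟩ : ∃ r, s = r + 1 := ⟨s - 1, by omega⟩
    rw [Finset.sum_range_succ']
    refine le_trans (le_of_eq ?_) (sum_pow_div_factorial_tail_le zero_le_one s)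
    simp [momentWeight]
  have h2 := six_le_factorial hs
  have h3 := exp_one_le
  nlinarith

theorem covWeight_succ_le {s : ℕ} (hs : 3 ≤ s) : covWeight (s + 1) ≤ 4 / 3 * (s ! : ℝ) := by
  induction s, hs using Nat.le_induction with
  | base => norm_num [covWeight, Nat.factorial]
  | succ k hk ih =>
    have hk' : (3 : ℝ) ≤ k := by exact_mod_cast hk
    have e1 : covWeight (k + 1) = (k + 1) + ((k : ℝ) + 1) ^ 2 / 4 := by
      simp [covWeight, show k ≠ 0 by omega]
    have e2 : covWeight (k + 1 + 1) = (k + 1 + 1) + ((k : ℝ) + 1 + 1) ^ 2 / 4 := by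
      simp [covWeight]
    rw [e1] at ih
    rw [e2, Nat.factorial_succ]
    push_cast
    nlinarith

theorem covWeight_sum_le (s : ℕ) :
    ∑ i ∈ Finset.range s, covWeight (i + 1) / ((i + 1)! : ℝ) ≤ 2.83 := by
  have h1 : ∀ i : ℕ, covWeight (i + 1 + 1) / ((i + 1 + 1)! : ℝ) =
      5 / 4 * (1 / ((i + 1)! : ℝ)) + 1 / 4 * (1 / (i ! : ℝ)) := by
    intro i
    have e2 : covWeight (i + 1 + 1) = (i + 1 + 1) + ((i : ℝ) + 1 + 1) ^ 2 / 4 := by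
      simp [covWeight]
    have : (i ! : ℝ) ≠ 0 := by positivity
    rw [e2, Nat.factorial_succ, Nat.factorial_succ]
    push_cast
    field_simp
    ring
  have h0 : covWeight 1 = 0 := by simp [covWeight]
  rcases s with _ | s
  · norm_num
  rw [Finset.sum_range_succ', zero_add, h0]
  simp only [h1]
  rw [Finset.sum_add_distrib, ← Finset.mul_sum, ← Finset.mul_sum]
  have h2 := Real.sum_le_exp_of_nonneg zero_le_one (s + 1)
  have h3 := Real.sum_le_exp_of_nonneg zero_le_one s
  rw [Finset.sum_range_succ'] at h2
  simp only [one_pow, Nat.factorial_zero, Nat.cast_one, div_one] at h2 h3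
  have h4 := exp_one_le
  norm_num
  norm_num at h2 h3
  linarith

theorem cumulRate_sum_le (s : ℕ) :
    ∑ i ∈ Finset.range s, cumulRate (s - (i + 1)) * momentWeight (i + 1) / ((i + 1)! : ℝ) ≤
      2 / 3 * (3 / 2) ^ s := by
  have h1 : ∀ i ∈ Finset.range s, cumulRate (s - (i + 1)) * momentWeight (i + 1) / ((i + 1)! : ℝ) ≤
      2 * (3 / 2 : ℝ) ^ s * ((2 / 3) ^ (i + 1) / ((i + 1)! : ℝ) * momentWeight (i + 1)) := by
    intro i hi
    have hi := Finset.mem_range.1 hi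
    have h := cumulRate_le (s - (i + 1))
    have e : (3 / 2 : ℝ) ^ s * (2 / 3) ^ (i + 1) = (3 / 2) ^ (s - (i + 1)) := by
      conv_lhs => rw [show s = (s - (i + 1)) + (i + 1) by omega, pow_add, mul_assoc, ← mul_pow]
      norm_num
    have h0 := momentWeight_nonneg (i + 1)
    calc _ ≤ 2 * (3 / 2) ^ (s - (i + 1)) * momentWeight (i + 1) / ((i + 1)! : ℝ) := by gcongr
      _ = _ := by rw [← e]; ring
  refine (Finset.sum_le_sum h1).trans ?_
  rw [← Finset.mul_sum]
  have h2 : ∑ i ∈ Finset.range s, ((2 / 3 : ℝ) ^ (i + 1) / ((i + 1)! : ℝ) * momentWeight (i + 1)) ≤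
      1 / 3 := by
    rcases s with _ | s
    · norm_num
    rw [Finset.sum_range_succ']
    have h := sum_pow_div_factorial_tail_le (x := 2 / 3) (by norm_num) s
    have h' := exp_two_thirds_le
    have : ∑ i ∈ Finset.range s, ((2 / 3 : ℝ) ^ (i + 1 + 1) / ((i + 1 + 1)! : ℝ) *
        momentWeight (i + 1 + 1)) = ∑ i ∈ Finset.range s, (2 / 3 : ℝ) ^ (i + 2) / ((i + 2)! : ℝ) := by
      simp [momentWeight]
    rw [this]
    simp [momentWeight]
    linarith
  have : (0 : ℝ) < (3 / 2) ^ s := by positivity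
  nlinarith

theorem covWeight_cumulRate_sum_le (s : ℕ) :
    covWeight (s + 1) + ∑ c ∈ Finset.range s, (s.choose c : ℝ) *
      ((c ! : ℝ) * (covWeight (s - c) + cumulRate c * momentWeight (s - c))) ≤
      (s ! : ℝ) * cumulRate s := by
  rcases Nat.lt_or_ge s 3 with hs | hs
  · interval_cases s <;>
      norm_num [momentWeight, covWeight, cumulRate, Finset.sum_range_succ, Nat.factorial]
  rw [sum_choose_mul_factorial_reflect s (fun c i => covWeight i + cumulRate c * momentWeight i)]
  simp only [add_div, Finset.sum_add_distrib]
  have h1 := covWeight_succ_le hs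
  have h2 := covWeight_sum_le s
  have h3 := cumulRate_sum_le s
  have h4 : cumulRate s = 2 * (3 / 2) ^ s := by simp [cumulRate, show s ≠ 0 by omega]
  have h5 : (27 / 8 : ℝ) ≤ (3 / 2) ^ s := by
    calc (27 / 8 : ℝ) = (3 / 2) ^ 3 := by norm_num
      _ ≤ _ := pow_le_pow_right₀ (by norm_num) hs
  rw [h4]
  have h6 : (0 : ℝ) < (s ! : ℝ) := by positivity
  nlinarith

section CumulantBounds

variable {ι : Type*} [LinearOrder ι]

theorem sum_ssubsets_apply_card (S : Finset ι) (f : ℕ → ℝ) :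
    ∑ C ∈ S.ssubsets, f C.card = ∑ c ∈ Finset.range S.card, (S.card.choose c : ℝ) * f c := by
  have e : S.ssubsets = S.powerset.erase S := rfl
  have h := Finset.sum_powerset_apply_card f (x := S)
  rw [← Finset.add_sum_erase _ _ (Finset.mem_powerset_self S), ← e, Finset.sum_range_succ] at h
  simp only [nsmul_eq_mul, Nat.choose_self, Nat.cast_one, one_mul] at h
  linarith

/-- Joint cumulants are controlled by joint moments. -/
theorem abs_cumul_le (m : Finset ι → ℝ) (e : ℕ → ℝ) (he0 : ∀ k, 0 ≤ e k)
    (he : ∀ i j, e i * e j ≤ e (i + j))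
    (hm : ∀ A, m A = 0 ∨ A.card ≠ 1) (hm' : ∀ A, |m A| ≤ e A.card) {A : Finset ι}
    (hA : A.Nonempty) : |cumul m A| ≤ ((A.card - 1)! : ℝ) * e A.card := by
  have hmw : ∀ A, |m A| ≤ momentWeight A.card * e A.card := by
    intro A
    unfold momentWeight
    split_ifs with h
    · rcases hm A with h' | h'
      · simp [h']
      · exact absurd h h'
    · simpa using hm' A
  induction A using Finset.strongInductionOn with
  | _ A ih =>
    rw [cumul_eq m hA]
    set a := A.min' hA
    have haA : a ∈ A := A.min'_mem hA
    have hcard := Finset.card_erase_add_one haA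
    set S := A.erase a with hS
    have hterm : ∀ C ∈ S.ssubsets, |cumul m (insert a C) * m (S \ C)| ≤
        ((C.card)! : ℝ) * momentWeight (S.card - C.card) * e A.card := by
      intro C hC
      have hC := Finset.mem_ssubsets.1 hC
      have haC : a ∉ C := fun h => Finset.notMem_erase a A (hC.1 h)
      have hlt := card_insert_lt_of_ssubset_erase haA hC
      have hss : insert a C ⊂ A :=
        (Finset.insert_subset haA (hC.1.trans (Finset.erase_subset _ _))).ssubset_of_ne
          fun h => by rw [h] at hlt; exact lt_irrefl _ hlt
      have h1 := ih _ hss ⟨a, Finset.mem_insert_self _ _⟩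
      have h2 := hmw (S \ C)
      rw [Finset.card_sdiff_of_subset hC.1] at h2
      rw [Finset.card_insert_of_notMem haC, Nat.add_sub_cancel] at h1
      have h3 := he (C.card + 1) (S.card - C.card)
      have hle := Finset.card_lt_card hC
      rw [show C.card + 1 + (S.card - C.card) = A.card by omega] at h3
      rw [abs_mul]
      have := momentWeight_nonneg (S.card - C.card)
      calc _ ≤ ((C.card)! * e (C.card + 1)) * (momentWeight (S.card - C.card) * e (S.card - C.card)) :=
            mul_le_mul h1 h2 (abs_nonneg _) (mul_nonneg (by positivity) (he0 _))
        _ = (C.card)! * momentWeight (S.card - C.card) * (e (C.card + 1) * e (S.card - C.card)) := by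
            ring
        _ ≤ _ := by gcongr
    have hsum := (Finset.abs_sum_le_sum_abs _ _).trans (Finset.sum_le_sum hterm)
    rw [← Finset.sum_mul,
      sum_ssubsets_apply_card S (fun c => (c ! : ℝ) * momentWeight (S.card - c))] at hsum
    have hnum := momentWeight_sum_le S.card
    rw [hcard] at hnum
    have hmA := hmw A
    rw [← hcard, Nat.add_sub_cancel, hcard]
    calc _ ≤ _ := abs_sub _ _
      _ ≤ _ := add_le_add hmA hsum
      _ = _ := (add_mul _ _ _).symm
      _ ≤ _ := mul_le_mul_of_nonneg_right hnum (he0 _)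

/-- Stability of joint cumulants under a perturbation of the joint moments. -/
theorem abs_cumul_sub_cumul_le (m m' : Finset ι → ℝ) (e : ℕ → ℝ) (he0 : ∀ k, 0 ≤ e k)
    (he : ∀ i j, e i * e j ≤ e (i + j)) {Q : ℝ} (hQ : 0 ≤ Q)
    (hm : ∀ A, m A = 0 ∨ A.card ≠ 1) (hm' : ∀ A, |m A| ≤ e A.card)
    (hn : ∀ A, m' A = 0 ∨ A.card ≠ 1) (hn' : ∀ A, |m' A| ≤ e A.card)
    (hd : ∀ A, |m A - m' A| ≤ covWeight A.card * (Q * e A.card)) {A : Finset ι}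
    (hA : A.Nonempty) :
    |cumul m A - cumul m' A| ≤
      ((A.card - 1)! : ℝ) * cumulRate (A.card - 1) * (Q * e A.card) := by
  have hmw : ∀ A, |m' A| ≤ momentWeight A.card * e A.card := by
    intro A
    unfold momentWeight
    split_ifs with h
    · rcases hn A with h' | h'
      · simp [h']
      · exact absurd h h'
    · simpa using hn' A
  induction A using Finset.strongInductionOn with
  | _ A ih =>
    rw [cumul_eq m hA, cumul_eq m' hA]
    set a := A.min' hA
    have haA : a ∈ A := A.min'_mem hA
    have hcard := Finset.card_erase_add_one haA
    set S := A.erase a with hS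
    have hterm : ∀ C ∈ S.ssubsets,
        |cumul m (insert a C) * m (S \ C) - cumul m' (insert a C) * m' (S \ C)| ≤
        ((C.card)! : ℝ) * (covWeight (S.card - C.card) +
          cumulRate C.card * momentWeight (S.card - C.card)) * (Q * e A.card) := by
      intro C hC
      have hC := Finset.mem_ssubsets.1 hC
      have haC : a ∉ C := fun h => Finset.notMem_erase a A (hC.1 h)
      have hlt := card_insert_lt_of_ssubset_erase haA hC
      have hss : insert a C ⊂ A :=
        (Finset.insert_subset haA (hC.1.trans (Finset.erase_subset _ _))).ssubset_of_ne
          fun h => by rw [h] at hlt; exact lt_irrefl _ hlt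
      have h1 := ih _ hss ⟨a, Finset.mem_insert_self _ _⟩
      have h1' := abs_cumul_le m e he0 he hm hm' (A := insert a C) ⟨a, Finset.mem_insert_self _ _⟩
      have h2 := hmw (S \ C)
      have h2' := hd (S \ C)
      rw [Finset.card_sdiff_of_subset hC.1] at h2 h2'
      rw [Finset.card_insert_of_notMem haC, Nat.add_sub_cancel] at h1 h1'
      have h3 := he (C.card + 1) (S.card - C.card)
      have hle := Finset.card_lt_card hC
      rw [show C.card + 1 + (S.card - C.card) = A.card by omega] at h3
      have p1 := momentWeight_nonneg (S.card - C.card)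
      have p2 := covWeight_nonneg (S.card - C.card)
      have p3 := cumulRate_nonneg C.card
      have p4 := he0 (S.card - C.card)
      have p5 := he0 (C.card + 1)
      have e1 : cumul m (insert a C) * m (S \ C) - cumul m' (insert a C) * m' (S \ C) =
          cumul m (insert a C) * (m (S \ C) - m' (S \ C)) +
          (cumul m (insert a C) - cumul m' (insert a C)) * m' (S \ C) := by ring
      rw [e1]
      refine (abs_add_le _ _).trans ?_
      rw [abs_mul, abs_mul]
      calc _ ≤ ((C.card)! * e (C.card + 1)) *
              (covWeight (S.card - C.card) * (Q * e (S.card - C.card))) +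
            ((C.card)! * cumulRate C.card * (Q * e (C.card + 1))) *
              (momentWeight (S.card - C.card) * e (S.card - C.card)) := by gcongr
        _ = (C.card)! * (covWeight (S.card - C.card) +
              cumulRate C.card * momentWeight (S.card - C.card)) *
              (Q * (e (C.card + 1) * e (S.card - C.card))) := by ring
        _ ≤ _ := by gcongr
    have hsum := (Finset.abs_sum_le_sum_abs _ _).trans (Finset.sum_le_sum hterm)
    rw [← Finset.sum_mul, sum_ssubsets_apply_card S (fun c => (c ! : ℝ) *
      (covWeight (S.card - c) + cumulRate c * momentWeight (S.card - c)))] at hsum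
    have hnum := covWeight_cumulRate_sum_le S.card
    rw [hcard] at hnum
    have hmA := hd A
    rw [← hcard, Nat.add_sub_cancel, hcard]
    rw [Finset.sum_sub_distrib] at hsum
    calc _ = |(m A - m' A) - (∑ C ∈ S.ssubsets, cumul m (insert a C) * m (S \ C) -
          ∑ C ∈ S.ssubsets, cumul m' (insert a C) * m' (S \ C))| := by congr 1; ring
      _ ≤ _ := abs_sub _ _
      _ ≤ _ := add_le_add hmA hsum
      _ = _ := (add_mul _ _ _).symm
      _ ≤ _ := mul_le_mul_of_nonneg_right hnum (mul_nonneg hQ (he0 _))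

end CumulantBounds

/-- Joint cumulants are small on sets split into two weakly correlated parts. -/
theorem abs_cumul_le_of_split {ι : Type*} [LinearOrder ι] (m : Finset ι → ℝ) (hm0 : m ∅ = 1)
    (e : ℕ → ℝ) (he0 : ∀ k, 0 ≤ e k)
    (he : ∀ i j, e i * e j ≤ e (i + j)) {Q : ℝ} (hQ : 0 ≤ Q)
    (hm : ∀ A, m A = 0 ∨ A.card ≠ 1) (hm' : ∀ A, |m A| ≤ e A.card)
    (U : Set ι) [DecidablePred (· ∈ U)]
    (hd : ∀ A, (A.filter (· ∈ U)).Nonempty → (A.filter (· ∉ U)).Nonempty →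
      |m A - m (A.filter (· ∈ U)) * m (A.filter (· ∉ U))| ≤ covWeight A.card * (Q * e A.card))
    {A : Finset ι} (h1 : (A.filter (· ∈ U)).Nonempty) (h2 : (A.filter (· ∉ U)).Nonempty) :
    |cumul m A| ≤ ((A.card - 1)! : ℝ) * cumulRate (A.card - 1) * (Q * e A.card) := by
  have hA : A.Nonempty := h1.mono (Finset.filter_subset _ _)
  set m' : Finset ι → ℝ := fun A => m (A.filter (· ∈ U)) * m (A.filter (· ∉ U)) with hm'def
  have hcard : ∀ A : Finset ι, (A.filter (· ∈ U)).card + (A.filter (· ∉ U)).card = A.card :=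
    fun A => Finset.card_filter_add_card_filter_not _
  have hz : cumul m' A = 0 := by
    refine cumul_eq_zero_of_factor m' (by simp [hm'def, hm0]) U (fun A => ?_) A h1 h2
    simp [hm'def, Finset.filter_filter, hm0]
  have := abs_cumul_sub_cumul_le m m' e he0 he hQ hm hm' (fun A => ?_) (fun A => ?_)
    (fun A => ?_) hA
  · rwa [hz, sub_zero] at this
  · by_cases hc : A.card = 1
    · left
      have h := hcard A
      have : (A.filter (· ∈ U)).card = 1 ∨ (A.filter (· ∉ U)).card = 1 := by omega
      rcases this with h | h
      · rcases hm (A.filter (· ∈ U)) with h' | h'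
        · simp [hm'def, h']
        · exact absurd h h'
      · rcases hm (A.filter (· ∉ U)) with h' | h'
        · simp only [hm'def, h', mul_zero]
        · exact absurd h h'
    · exact Or.inr hc
  · rw [hm'def, abs_mul, ← hcard A]
    exact (mul_le_mul (hm' _) (hm' _) (abs_nonneg _) (he0 _)).trans (he _ _)
  · rcases (A.filter (· ∈ U)).eq_empty_or_nonempty with ha | ha
    · have : A.filter (· ∉ U) = A := by
        rw [Finset.filter_eq_self]
        intro i hi hiU
        exact Finset.notMem_empty i (ha ▸ Finset.mem_filter.2 ⟨hi, hiU⟩)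
      simp only [hm'def, ha, this, hm0, one_mul, sub_self, abs_zero]
      exact mul_nonneg (covWeight_nonneg _) (mul_nonneg hQ (he0 _))
    rcases (A.filter (· ∉ U)).eq_empty_or_nonempty with hb | hb
    · have : A.filter (· ∈ U) = A := by
        rw [Finset.filter_eq_self]
        intro i hi
        by_contra hiU
        exact Finset.notMem_empty i (hb ▸ Finset.mem_filter.2 ⟨hi, hiU⟩)
      simp only [hm'def, hb, this, hm0, mul_one, sub_self, abs_zero]
      exact mul_nonneg (covWeight_nonneg _) (mul_nonneg hQ (he0 _))
    exact hd A ha hb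

theorem sum_max_coord_le {q n : ℕ} (ρ : ℕ → ℝ) (hρ0 : ∀ s, 0 ≤ ρ s) (j : Fin (q + 1)) :
    ∑ d : Fin (q + 1) → Fin n, (if ∀ i, d i ≤ d j then ρ (d j) else 0) ≤
      ∑ s ∈ Finset.range n, ((s : ℝ) + 1) ^ q * ρ s := by
  classical
  rw [← Finset.sum_fiberwise Finset.univ (fun d : Fin (q + 1) → Fin n => d j),
    ← Fin.sum_univ_eq_sum_range (fun s => ((s : ℝ) + 1) ^ q * ρ s)]
  refine Finset.sum_le_sum fun s _ => ?_
  rw [← Finset.sum_filter, Finset.filter_filter]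
  have hsub : Finset.univ.filter (fun d : Fin (q + 1) → Fin n => d j = s ∧ ∀ i, d i ≤ d j) ⊆
      Fintype.piFinset (fun i => if i = j then {s} else Finset.Iic s) := by
    intro d hd
    simp only [Finset.mem_filter, Finset.mem_univ, true_and] at hd
    rw [Fintype.mem_piFinset]
    intro i
    split_ifs with h
    · simp [h, hd.1]
    · rw [Finset.mem_Iic, ← hd.1]; exact hd.2 i
  have hcard : (Fintype.piFinset (fun i : Fin (q + 1) => if i = j then {s} else Finset.Iic s)).card
      = ((s : ℕ) + 1) ^ q := by
    rw [Fintype.card_piFinset, ← Finset.mul_prod_erase _ _ (Finset.mem_univ j), if_pos rfl]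
    rw [Finset.prod_congr rfl (g := fun _ => (s : ℕ) + 1)]
    · simp
    · intro i hi
      rw [if_neg (Finset.ne_of_mem_erase hi)]
      simp
  calc _ = ∑ d ∈ Finset.univ.filter (fun d : Fin (q + 1) → Fin n => d j = s ∧ ∀ i, d i ≤ d j),
        ρ s := by
          refine Finset.sum_congr rfl fun d hd => ?_
          rw [(Finset.mem_filter.1 hd).2.1]
    _ ≤ _ := by
      rw [Finset.sum_const, nsmul_eq_mul]
      refine mul_le_mul_of_nonneg_right ?_ (hρ0 _)
      have := Finset.card_le_card hsub
      rw [hcard] at this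
      exact_mod_cast this

/-- Summation over all index tuples of a function controlled by the largest gap of the tuple. -/
theorem sum_le_of_gap_fin {q n : ℕ} (ρ : ℕ → ℝ) (hρ0 : ∀ s, 0 ≤ ρ s)
    (f : (Fin (q + 2) → Fin n) → ℝ)
    (hf : ∀ t, ∀ U : Set (Fin (q + 2)), U.Nonempty → Uᶜ.Nonempty → ∀ r : ℕ,
      (∀ i ∈ U, ∀ j ∉ U, (t i : ℕ) + r ≤ t j) → f t ≤ ρ r) :
    ∑ t, f t ≤ n * ((q + 2)! : ℝ) * (q + 1) *
      ∑ s ∈ Finset.range n, ((s : ℝ) + 1) ^ q * ρ s := by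
  classical
  let gap : (Fin (q + 2) → Fin n) → Fin (q + 1) → Fin n := fun t i =>
    ⟨(t (Tuple.sort t i.succ) : ℕ) - t (Tuple.sort t i.castSucc), by omega⟩
  let F : (Fin (q + 1) → Fin n) → ℝ := fun d => ∑ j, if ∀ i, d i ≤ d j then ρ (d j) else 0
  have hF0 : ∀ d, 0 ≤ F d := fun d => Finset.sum_nonneg fun j _ => by
    split_ifs
    · exact hρ0 _
    · exact le_rfl
  let Φ : (Fin (q + 2) → Fin n) → Equiv.Perm (Fin (q + 2)) × Fin n × (Fin (q + 1) → Fin n) :=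
    fun t => (Tuple.sort t, t (Tuple.sort t 0), gap t)
  have hmono : ∀ t : Fin (q + 2) → Fin n, ∀ i : Fin (q + 1),
      (t (Tuple.sort t i.castSucc) : ℕ) ≤ t (Tuple.sort t i.succ) := fun t i =>
    Tuple.monotone_sort t (Fin.castSucc_le_succ i)
  have hΦ : Function.Injective Φ := by
    intro t t' h
    simp only [Φ, Prod.mk.injEq] at h
    obtain ⟨hσ, h0, hg⟩ := h
    have key : ∀ i : Fin (q + 2), t (Tuple.sort t i) = t' (Tuple.sort t' i) := by
      intro i
      induction i using Fin.induction with
      | zero => exact h0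
      | succ i ih =>
        have h1 := congrFun hg i
        simp only [gap, Fin.mk.injEq] at h1
        have h2 := hmono t i
        have h3 := hmono t' i
        rw [ih] at h1 h2
        exact Fin.ext (by omega)
    funext i
    have := key ((Tuple.sort t).symm i)
    rw [← hσ] at this
    simpa using this
  have hle : ∀ t, f t ≤ F (gap t) := by
    intro t
    obtain ⟨j, hj⟩ := Finite.exists_max (gap t)
    have h1 : f t ≤ ρ (gap t j) := by
      refine hf t {i | (Tuple.sort t).symm i ≤ j.castSucc} ⟨Tuple.sort t 0, by simp⟩
        ⟨Tuple.sort t j.succ, by simp⟩ _ fun a ha b hb => ?_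
      simp only [Set.mem_ofPred_eq, not_le] at ha hb
      have m1 : t a ≤ t (Tuple.sort t j.castSucc) := by
        have := Tuple.monotone_sort t ha
        simpa using this
      have m2 : t (Tuple.sort t j.succ) ≤ t b := by
        have := Tuple.monotone_sort t (Fin.castSucc_lt_iff_succ_le.1 hb)
        simpa using this
      have m3 := hmono t j
      simp only [gap]
      have m1' : (t a : ℕ) ≤ t (Tuple.sort t j.castSucc) := m1
      have m2' : (t (Tuple.sort t j.succ) : ℕ) ≤ t b := m2
      omega
    refine h1.trans ?_
    refine le_trans (le_of_eq (if_pos hj).symm)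
      (Finset.single_le_sum (f := fun j => if ∀ i, gap t i ≤ gap t j then ρ (gap t j) else 0)
        (fun j _ => ?_) (Finset.mem_univ j))
    split_ifs
    · exact hρ0 _
    · exact le_rfl
  calc ∑ t, f t ≤ ∑ t, F (Φ t).2.2 := Finset.sum_le_sum fun t _ => hle t
    _ = ∑ x ∈ Finset.univ.map ⟨Φ, hΦ⟩, F x.2.2 := by rw [Finset.sum_map]; rfl
    _ ≤ ∑ x : Equiv.Perm (Fin (q + 2)) × Fin n × (Fin (q + 1) → Fin n), F x.2.2 :=
        Finset.sum_le_univ_sum_of_nonneg fun x => hF0 _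
    _ = n * ((q + 2)! : ℝ) * ∑ d, F d := by
        rw [Fintype.sum_prod_type]
        simp only [Fintype.sum_prod_type, Finset.sum_const, Finset.card_univ, Fintype.card_perm,
          Fintype.card_fin, nsmul_eq_mul]
        ring
    _ ≤ n * ((q + 2)! : ℝ) * ((q + 1) * ∑ s ∈ Finset.range n, ((s : ℝ) + 1) ^ q * ρ s) := by
        refine mul_le_mul_of_nonneg_left ?_ (by positivity)
        simp only [F]
        rw [Finset.sum_comm]
        refine (Finset.sum_le_sum fun j _ => sum_max_coord_le ρ hρ0 j).trans ?_
        simp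
    _ = _ := by ring

theorem sum_le_of_gap {ι : Type*} [Fintype ι] {q n : ℕ} (hι : Fintype.card ι = q + 2) (ρ : ℕ → ℝ)
    (hρ0 : ∀ s, 0 ≤ ρ s) [DecidableEq ι] (f : (ι → Fin n) → ℝ)
    (hf : ∀ t, ∀ U : Set ι, U.Nonempty → Uᶜ.Nonempty → ∀ r : ℕ,
      (∀ i ∈ U, ∀ j ∉ U, (t i : ℕ) + r ≤ t j) → f t ≤ ρ r) :
    ∑ t, f t ≤ n * ((q + 2)! : ℝ) * (q + 1) *
      ∑ s ∈ Finset.range n, ((s : ℝ) + 1) ^ q * ρ s := by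
  let g : ι ≃ Fin (q + 2) := Fintype.equivFinOfCardEq hι
  rw [← (g.symm.arrowCongr (Equiv.refl (Fin n))).sum_comp f]
  refine sum_le_of_gap_fin ρ hρ0 _ fun t U hU hU' r h => ?_
  refine hf _ (g ⁻¹' U) ?_ ?_ r fun i hi j hj => ?_
  · obtain ⟨x, hx⟩ := hU
    exact ⟨g.symm x, by simpa using hx⟩
  · obtain ⟨x, hx⟩ := hU'
    exact ⟨g.symm x, by simpa using hx⟩
  · simpa using h (g i) hi (g j) hj

section Moments

variable {Ω : Type*} [MeasurableSpace Ω] {P : Measure Ω}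

theorem memLp_of_integrable_abs_pow {f : Ω → ℝ} (hf : Measurable f)
    (h : ∀ k : ℕ, Integrable (fun ω => |f ω| ^ k) P) (p : ℕ) : MemLp f p P := by
  rcases Nat.eq_zero_or_pos p with rfl | hp
  · simpa using hf.aestronglyMeasurable
  refine (integrable_norm_rpow_iff hf.aestronglyMeasurable (by exact_mod_cast hp.ne')
    (ENNReal.natCast_ne_top p)).1 ?_
  simpa using h p

variable [IsProbabilityMeasure P]

theorem memLp_prod_of_memLp {κ : Type*} (A : Finset κ) {f : κ → Ω → ℝ}
    (h : ∀ i, ∀ p : ℕ, MemLp (f i) p P) (p : ℕ) : MemLp (fun ω => ∏ i ∈ A, f i ω) p P := by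
  classical
  induction A using Finset.induction_on with
  | empty => simpa using memLp_const (1 : ℝ)
  | insert a A ha ih =>
    have h1 := MemLp.prod' (s := insert a A) (p := fun _ => ((p * (insert a A).card : ℕ) : ENNReal))
      (fun i _ => h i (p * (insert a A).card))
    have hc : (((insert a A).card : ℕ) : ENNReal) ≠ 0 := by
      simp [ha]
    convert h1 using 1
    rw [Finset.sum_const, nsmul_eq_mul, Nat.cast_mul,
      ENNReal.mul_inv (Or.inr (ENNReal.natCast_ne_top _)) (Or.inr hc), mul_comm (p : ENNReal)⁻¹,
      ← mul_assoc, ENNReal.mul_inv_cancel hc (ENNReal.natCast_ne_top _), one_mul, inv_inv]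

theorem prod_abs_le_mean_pow {κ : Type*} (A : Finset κ) (hA : A.Nonempty) (x : κ → ℝ) :
    ∏ i ∈ A, |x i| ≤ (A.card : ℝ)⁻¹ * ∑ i ∈ A, |x i| ^ A.card := by
  have hc : (A.card : ℝ) ≠ 0 := by
    have := hA.card_pos
    positivity
  have h := Real.geom_mean_le_arith_mean_weighted A (fun _ => (A.card : ℝ)⁻¹)
    (fun i => |x i| ^ A.card) (fun _ _ => by positivity) (by simp [hc]) (fun _ _ => by positivity)
  rw [← Finset.mul_sum] at h
  refine le_trans (le_of_eq (Finset.prod_congr rfl fun i _ => ?_)) h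
  rw [← Real.rpow_natCast, ← Real.rpow_mul (abs_nonneg _), mul_inv_cancel₀ hc, Real.rpow_one]

theorem abs_integral_prod_le {κ : Type*} (A : Finset κ) {f : κ → Ω → ℝ} {c : ℕ → ℝ} (hc0 : 1 ≤ c 0)
    (h : ∀ i, ∀ k : ℕ, Integrable (fun ω => |f i ω| ^ k) P)
    (hc : ∀ i, ∀ k : ℕ, ∫ ω, |f i ω| ^ k ∂P ≤ c k) :
    |∫ ω, ∏ i ∈ A, f i ω ∂P| ≤ c A.card := by
  rcases A.eq_empty_or_nonempty with rfl | hA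
  · simpa using hc0
  have hcard : (A.card : ℝ) ≠ 0 := by
    have := hA.card_pos
    positivity
  calc |∫ ω, ∏ i ∈ A, f i ω ∂P| ≤ ∫ ω, |∏ i ∈ A, f i ω| ∂P := abs_integral_le_integral_abs
    _ ≤ ∫ ω, (A.card : ℝ)⁻¹ * ∑ i ∈ A, |f i ω| ^ A.card ∂P := by
        refine integral_mono_of_nonneg (Filter.Eventually.of_forall fun _ => abs_nonneg _)
          ((integrable_finsetSum _ fun i _ => h i _).const_mul _)
          (Filter.Eventually.of_forall fun ω => ?_)
        simp only [Finset.abs_prod]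
        exact prod_abs_le_mean_pow A hA fun i => f i ω
    _ = (A.card : ℝ)⁻¹ * ∑ i ∈ A, ∫ ω, |f i ω| ^ A.card ∂P := by
        rw [integral_const_mul, integral_finsetSum _ fun i _ => h i _]
    _ ≤ (A.card : ℝ)⁻¹ * ∑ i ∈ A, c A.card := by
        gcongr with i _
        exact hc i _
    _ = c A.card := by
        rw [Finset.sum_const, nsmul_eq_mul, inv_mul_cancel_left₀ hcard]

theorem exists_monotone_enum {κ : Type*} {n : ℕ} (C : Finset κ) (t : κ → Fin n) :
    ∃ s : Fin C.card → Fin n, Monotone s ∧ (∀ k, ∃ i ∈ C, s k = t i) ∧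
      ∀ g : Fin n → ℝ, ∏ k, g (s k) = ∏ i ∈ C, g (t i) := by
  let f : Fin C.card → Fin n := fun k => t (C.equivFin.symm k)
  refine ⟨f ∘ Tuple.sort f, Tuple.monotone_sort f, fun k => ⟨_, (C.equivFin.symm _).2, rfl⟩,
    fun g => ?_⟩
  rw [← Finset.prod_coe_sort C]
  exact (((Tuple.sort f).trans C.equivFin.symm).prod_comp fun i : C => g (t i))

end Moments

theorem WeakDependenceType.weight_le (τ : WeakDependenceType) {u v : ℕ} (hu : 0 < u) (hv : 0 < v) :
    (τ.weight u v : ℝ) ≤ covWeight (u + v) := by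
  have h1 : τ.weight u v ≤ u + v + u * v := by
    cases τ <;> simp only [WeakDependenceType.weight] <;> nlinarith
  have h2 : (τ.weight u v : ℝ) ≤ u + v + u * v := by exact_mod_cast h1
  rw [covWeight, if_neg (by omega)]
  push_cast
  nlinarith [sq_nonneg ((u : ℝ) - v)]

/-- The scale `(k!)ᵇ Mᵏ` of absolute moments. -/
noncomputable def momentScale (b M : ℝ) (k : ℕ) : ℝ := (k ! : ℝ) ^ b * M ^ k

theorem momentScale_nonneg {M : ℝ} (hM : 0 < M) (b : ℝ) (k : ℕ) : 0 ≤ momentScale b M k := by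
  unfold momentScale; positivity

theorem momentScale_mul_le {b M : ℝ} (hM : 0 < M) (hb : 0 ≤ b) (i j : ℕ) :
    momentScale b M i * momentScale b M j ≤ momentScale b M (i + j) := by
  unfold momentScale
  have h : ((i ! : ℝ)) * (j ! : ℝ) ≤ ((i + j)! : ℝ) := by
    exact_mod_cast Nat.le_of_dvd (Nat.factorial_pos _) (Nat.factorial_mul_factorial_dvd_factorial_add i j)
  calc _ = ((i ! : ℝ) * (j ! : ℝ)) ^ b * M ^ (i + j) := by
        rw [Real.mul_rpow (by positivity) (by positivity), pow_add]; ring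
    _ ≤ _ := by gcongr

section JointMoments

variable {Ω : Type*} [MeasurableSpace Ω] {n : ℕ} {κ : Type*}

/-- The joint moments of the variables `X (t i)`. -/
noncomputable def jointMoment (P : Measure Ω) (X : Fin n → Ω → ℝ) (t : κ → Fin n) (A : Finset κ) :
    ℝ := ∫ ω, ∏ i ∈ A, X (t i) ω ∂P

variable {P : Measure Ω} {X : Fin n → Ω → ℝ}

theorem jointMoment_card_one (h0 : ∀ i, ∫ ω, X i ω ∂P = 0) (t : κ → Fin n) (A : Finset κ) :
    jointMoment P X t A = 0 ∨ A.card ≠ 1 := by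
  by_cases h : A.card = 1
  · obtain ⟨i, rfl⟩ := Finset.card_eq_one.1 h
    left
    simpa [jointMoment] using h0 (t i)
  · exact Or.inr h

variable [IsProbabilityMeasure P]

theorem jointMoment_empty (t : κ → Fin n) : jointMoment P X t ∅ = 1 := by
  simp [jointMoment]

theorem abs_jointMoment_sub_le (hXmeas : ∀ i, Measurable (X i))
    (τ : WeakDependenceType) (K M b : ℝ) (hM : 0 < M)
    (ρ : ℕ → ℝ) (hρ : Antitone ρ)
    (hcov : ∀ (u v : ℕ) (hu : 0 < u) (hv : 0 < v) (s : Fin u → Fin n) (t : Fin v → Fin n),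
      Monotone s → Monotone t → s ⟨u - 1, Nat.sub_lt hu one_pos⟩ ≤ t ⟨0, hv⟩ →
      |cov[fun ω => ∏ i, X (s i) ω, fun ω => ∏ j, X (t j) ω; P]| ≤
        K ^ 2 * M ^ (u + v) * (((u + v)! : ℕ) : ℝ) ^ b * (τ.weight u v : ℝ) *
          ρ ((t ⟨0, hv⟩ : ℕ) - (s ⟨u - 1, Nat.sub_lt hu one_pos⟩ : ℕ)))
    (hρ0 : ∀ s, 0 ≤ ρ s)
    (hmom : ∀ (i : Fin n) (k : ℕ), Integrable (fun ω => |X i ω| ^ k) P)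
    (t : κ → Fin n) (U : Set κ) [DecidablePred (· ∈ U)] (r : ℕ)
    (hr : ∀ i ∈ U, ∀ j ∉ U, (t i : ℕ) + r ≤ t j) (A : Finset κ)
    (h1 : (A.filter (· ∈ U)).Nonempty) (h2 : (A.filter (· ∉ U)).Nonempty) :
    |jointMoment P X t A - jointMoment P X t (A.filter (· ∈ U)) *
        jointMoment P X t (A.filter (· ∉ U))| ≤
      covWeight A.card * (K ^ 2 * ρ r * momentScale b M A.card) := by
  obtain ⟨s, hs, hsm, hsp⟩ := exists_monotone_enum (A.filter (· ∈ U)) t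
  obtain ⟨s', hs', hsm', hsp'⟩ := exists_monotone_enum (A.filter (· ∉ U)) t
  have hu := h1.card_pos
  have hv := h2.card_pos
  have hcard : (A.filter (· ∈ U)).card + (A.filter (· ∉ U)).card = A.card :=
    Finset.card_filter_add_card_filter_not _
  obtain ⟨i, hi, hsi⟩ := hsm ⟨_, Nat.sub_lt hu one_pos⟩
  obtain ⟨j, hj, hsj⟩ := hsm' ⟨0, hv⟩
  have hij := hr i (Finset.mem_filter.1 hi).2 j (Finset.mem_filter.1 hj).2
  have hc := hcov _ _ hu hv s s' hs hs' (by
    rw [hsi, hsj, Fin.le_def]; omega)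
  rw [hsi, hsj] at hc
  have hL : ∀ i, ∀ p : ℕ, MemLp (X i) p P := fun i =>
    memLp_of_integrable_abs_pow (hXmeas i) (hmom i)
  have hL2 : ∀ B : Finset κ, MemLp (fun ω => ∏ i ∈ B, X (t i) ω) 2 P := fun B => by
    exact_mod_cast memLp_prod_of_memLp B (fun i => hL (t i)) 2
  rw [show (fun ω => ∏ i, X (s i) ω) = fun ω => ∏ i ∈ A.filter (· ∈ U), X (t i) ω from
      funext fun ω => hsp fun i => X i ω,
    show (fun ω => ∏ i, X (s' i) ω) = fun ω => ∏ i ∈ A.filter (· ∉ U), X (t i) ω from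
      funext fun ω => hsp' fun i => X i ω,
    covariance_eq_sub (hL2 _) (hL2 _)] at hc
  have hprod : ((fun ω => ∏ i ∈ A.filter (· ∈ U), X (t i) ω) *
      fun ω => ∏ i ∈ A.filter (· ∉ U), X (t i) ω) = fun ω => ∏ i ∈ A, X (t i) ω := by
    funext ω
    exact Finset.prod_filter_mul_prod_filter_not A (· ∈ U) fun i => X (t i) ω
  rw [hprod, hcard] at hc
  refine hc.trans ?_
  have hw := τ.weight_le hu hv
  rw [hcard] at hw
  have hρr : ρ ((t j : ℕ) - (t i : ℕ)) ≤ ρ r := hρ (by omega)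
  calc _ ≤ K ^ 2 * M ^ A.card * ((A.card ! : ℕ) : ℝ) ^ b * covWeight A.card * ρ r := by
        have := hρ0 ((t j : ℕ) - (t i : ℕ))
        have := covWeight_nonneg A.card
        gcongr
    _ = _ := by unfold momentScale; ring

theorem integral_sum_pow_eq [Fintype κ] [DecidableEq κ] (hXmeas : ∀ i, Measurable (X i))
    (hmom : ∀ (i : Fin n) (k : ℕ), Integrable (fun ω => |X i ω| ^ k) P) :
    ∫ ω, (∑ i, X i ω) ^ (Fintype.card κ) ∂P =
      ∑ t : κ → Fin n, jointMoment P X t Finset.univ := by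
  unfold jointMoment
  rw [← integral_finsetSum]
  · refine integral_congr_ae (Filter.Eventually.of_forall fun ω => ?_)
    have := Finset.prod_univ_sum (fun _ : κ => (Finset.univ : Finset (Fin n))) fun _ i => X i ω
    simpa using this
  · intro t _
    have hL : ∀ i, ∀ p : ℕ, MemLp (X i) p P := fun i =>
      memLp_of_integrable_abs_pow (hXmeas i) (hmom i)
    have := memLp_prod_of_memLp Finset.univ (fun i => hL (t i)) 1
    exact memLp_one_iff_integrable.1 (by exact_mod_cast this)

end JointMoments

theorem cumul_map {ι κ : Type*} [LinearOrder ι] [LinearOrder κ] (e : ι ↪o κ) (m : Finset κ → ℝ)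
    (A : Finset ι) :
    cumul m (A.map e.toEmbedding) = cumul (fun C => m (C.map e.toEmbedding)) A := by
  induction A using Finset.strongInductionOn with
  | _ A ih =>
    rcases A.eq_empty_or_nonempty with rfl | hA
    · simp [cumul]
    have hA' : (A.map e.toEmbedding).Nonempty := hA.map
    have hmin : (A.map e.toEmbedding).min' hA' = e (A.min' hA) := by
      refine le_antisymm (Finset.min'_le _ _ (Finset.mem_map_of_mem _ (A.min'_mem hA))) ?_
      refine Finset.le_min' _ _ _ fun y hy => ?_
      obtain ⟨x, hx, rfl⟩ := Finset.mem_map.1 hy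
      exact e.monotone (A.min'_le x hx)
    rw [cumul_eq _ hA', cumul_eq _ hA, hmin]
    have herase : (A.map e.toEmbedding).erase (e (A.min' hA)) =
        (A.erase (A.min' hA)).map e.toEmbedding := (Finset.map_erase _ _ _).symm
    rw [herase]
    congr 1
    symm
    refine Finset.sum_bij (fun C _ => C.map e.toEmbedding) ?_ ?_ ?_ ?_
    · intro C hC
      rw [Finset.mem_ssubsets] at hC ⊢
      exact Finset.map_ssubset_map.2 hC
    · intro C _ C' _ h
      exact Finset.map_injective _ h
    · intro D hD
      rw [Finset.mem_ssubsets] at hD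
      obtain ⟨C, -, rfl⟩ := Finset.subset_map_iff.1 hD.1
      exact ⟨C, Finset.mem_ssubsets.2 (Finset.map_ssubset_map.1 hD), rfl⟩
    · intro C hC
      rw [Finset.mem_ssubsets] at hC
      have hlt := card_insert_lt_of_ssubset_erase (A.min'_mem hA) hC
      have hss : insert (A.min' hA) C ⊂ A :=
        (Finset.insert_subset (A.min'_mem hA) (hC.1.trans (Finset.erase_subset _ _))).ssubset_of_ne
          fun h => by rw [h] at hlt; exact lt_irrefl _ hlt
      rw [← ih _ hss, Finset.map_insert]
      congr 2
      ext y
      simp only [Finset.mem_sdiff, Finset.mem_map]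
      constructor
      · rintro ⟨x, ⟨hx, hx'⟩, rfl⟩
        refine ⟨⟨x, hx, rfl⟩, fun ⟨z, hz, hzx⟩ => hx' ?_⟩
        rwa [e.toEmbedding.injective hzx] at hz
      · rintro ⟨⟨x, hx, rfl⟩, h⟩
        exact ⟨x, ⟨hx, fun hx' => h ⟨x, hx', rfl⟩⟩, rfl⟩

theorem jointMoment_map {Ω : Type*} [MeasurableSpace Ω] {P : Measure Ω} {n : ℕ} {ι κ : Type*}
    (e : ι ↪ κ) (X : Fin n → Ω → ℝ) (t : κ → Fin n) (A : Finset ι) :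
    jointMoment P X t (A.map e) = jointMoment P X (t ∘ e) A := by
  simp [jointMoment]

section Recursion

variable {Ω : Type*} [MeasurableSpace Ω] {P : Measure Ω} {n : ℕ}
  {X : Fin n → Ω → ℝ}

theorem sum_cumul_mul_jointMoment {ι : Type*} [LinearOrder ι] [Fintype ι] (B : Finset ι) :
    ∑ t : ι → Fin n, cumul (jointMoment P X t) B * jointMoment P X t Bᶜ =
      (∑ t : {i // i ∈ B} → Fin n, cumul (jointMoment P X t) Finset.univ) *
        ∑ t : {i // i ∉ B} → Fin n, jointMoment P X t Finset.univ := by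
  rw [Finset.sum_mul_sum, ← Fintype.sum_prod_type',
    ← (Equiv.piEquivPiSubtypeProd (· ∈ B) fun _ => Fin n).sum_comp]
  refine Finset.sum_congr rfl fun t _ => ?_
  congr 1
  · have hB : B = (Finset.univ : Finset {i // i ∈ B}).map
        (OrderEmbedding.subtype (· ∈ B)).toEmbedding := by
      ext i; simp
    conv_lhs => rw [hB, cumul_map]
    refine cumul_congr fun C _ => ?_
    exact jointMoment_map _ X t C
  · have hB : Bᶜ = (Finset.univ : Finset {i // i ∉ B}).map
        (Function.Embedding.subtype (· ∉ B)) := by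
      ext i; simp
    conv_lhs => rw [hB, jointMoment_map]
    rfl

variable [IsProbabilityMeasure P]

/-- A moment-cumulant inequality for the sum of the variables. -/
theorem abs_moment_succ_le (hXmeas : ∀ i, Measurable (X i))
    (hmom : ∀ (i : Fin n) (k : ℕ), Integrable (fun ω => |X i ω| ^ k) P) (G : ℕ → ℝ) (k : ℕ)
    (hG : ∀ B : Finset (Fin (k + 1)), B.Nonempty →
      ∑ t : {i // i ∈ B} → Fin n, |cumul (jointMoment P X t) Finset.univ| ≤ G B.card) :
    |∫ ω, (∑ i, X i ω) ^ (k + 1) ∂P| ≤ ∑ c ∈ Finset.range (k + 1),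
      (k.choose c : ℝ) * (G (c + 1) * |∫ ω, (∑ i, X i ω) ^ (k - c) ∂P|) := by
  have h := integral_sum_pow_eq (κ := Fin (k + 1)) hXmeas hmom
  rw [Fintype.card_fin] at h
  have hne : (Finset.univ : Finset (Fin (k + 1))).Nonempty := Finset.univ_nonempty
  have e1 : ∀ t : Fin (k + 1) → Fin n, jointMoment P X t Finset.univ = _ := fun t =>
    eq_sum_cumul_mul (jointMoment P X t) (jointMoment_empty t) hne
  set a := Finset.univ.min' hne
  have hScard : (Finset.univ.erase a).card = k := by
    rw [Finset.card_erase_of_mem (Finset.mem_univ a)]; simp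
  set S := (Finset.univ : Finset (Fin (k + 1))).erase a with hS
  rw [h, Finset.sum_congr rfl fun t _ => e1 t, Finset.sum_comm]
  have hterm : ∀ C ∈ S.powerset, |∑ t : Fin (k + 1) → Fin n,
      cumul (jointMoment P X t) (insert a C) * jointMoment P X t (S \ C)| ≤
      G (C.card + 1) * |∫ ω, (∑ i, X i ω) ^ (k - C.card) ∂P| := by
    intro C hC
    rw [Finset.mem_powerset] at hC
    have haC : a ∉ C := fun h => Finset.notMem_erase a _ (hC h)
    have hcompl : S \ C = (insert a C)ᶜ := by
      ext i
      simp [hS]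
    have hGC := hG (insert a C) ⟨a, Finset.mem_insert_self _ _⟩
    rw [Finset.card_insert_of_notMem haC] at hGC
    have hcard : Fintype.card {i // i ∉ insert a C} = k - C.card := by
      rw [Fintype.card_subtype_compl, Fintype.card_fin, Fintype.card_coe,
        Finset.card_insert_of_notMem haC, Nat.add_sub_add_right]
    have hmomC := integral_sum_pow_eq (κ := {i // i ∉ insert a C}) hXmeas hmom
    rw [hcard] at hmomC
    rw [hcompl, sum_cumul_mul_jointMoment, abs_mul, hmomC]
    exact mul_le_mul_of_nonneg_right ((Finset.abs_sum_le_sum_abs _ _).trans hGC) (abs_nonneg _)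
  refine (Finset.abs_sum_le_sum_abs _ _).trans ((Finset.sum_le_sum hterm).trans (le_of_eq ?_))
  rw [Finset.sum_powerset_apply_card (fun c => G (c + 1) * |∫ ω, (∑ i, X i ω) ^ (k - c) ∂P|),
    hScard]
  simp

end Recursion

/-- Bound for the cumulants of the sum, of the form required in the tail estimate. -/
noncomputable def cumulantBound (a b H δ : ℝ) (k : ℕ) : ℝ :=
  if k ≤ 1 then 0 else 3 / 4 * ((k ! : ℝ) / 2) ^ (a + b + 2) * H * δ ^ (k - 2)

theorem three_pow_le (q : ℕ) : 8 * ((q : ℝ) + 1) * 3 ^ (q + 1) ≤ 3 * (q + 2) * 4 ^ (q + 1) := by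
  induction q with
  | zero => norm_num
  | succ q ih =>
    push_cast
    have h3 : (0 : ℝ) < 3 ^ (q + 1) := by positivity
    have hq : (0 : ℝ) ≤ q := by positivity
    have e3 : (3 : ℝ) ^ (q + 1 + 1) = 3 * 3 ^ (q + 1) := by ring
    have e4 : (4 : ℝ) ^ (q + 1 + 1) = 4 * 4 ^ (q + 1) := by ring
    rw [e3, e4]
    have h1 : ((q : ℝ) + 2) * (8 * (q + 1 + 1) * (3 * 3 ^ (q + 1))) ≤
        (q + 3) * 4 * (8 * ((q : ℝ) + 1) * 3 ^ (q + 1)) := by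
      have p : 24 * ((q : ℝ) + 2) ^ 2 ≤ 32 * (q + 3) * (q + 1) := by nlinarith
      nlinarith [mul_le_mul_of_nonneg_right p h3.le]
    have h2 : (q + 3) * 4 * (8 * ((q : ℝ) + 1) * 3 ^ (q + 1)) ≤
        (q + 3) * 4 * (3 * (q + 2) * 4 ^ (q + 1)) := by gcongr
    have h4 : (0 : ℝ) < (q : ℝ) + 2 := by positivity
    refine le_of_mul_le_mul_left ?_ h4
    nlinarith

theorem cumulant_constant_le {a b K M L₁ L₂ : ℝ} (hM : 0 < M) (hL₁ : 0 < L₁)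
    (hL₂ : 0 < L₂) (ha : 0 ≤ a) (n q : ℕ) :
    n * ((q + 2)! : ℝ) * (q + 1) * ((((q + 1)! : ℝ) * cumulRate (q + 1) * (K ^ 2 *
      momentScale b M (q + 2))) * (L₁ * L₂ ^ q * ((q ! : ℕ) : ℝ) ^ a)) ≤
    cumulantBound a b ((2 : ℝ) ^ (a + b + 2) * K ^ 2 * M ^ 2 * L₁ * max (K ^ 2) 2 * n)
      (M * L₂ * max (K ^ 2) 2) (q + 2) := by
  set κ := max (K ^ 2) 2
  have hκ : 2 ≤ κ := le_max_right _ _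
  have e1 : cumulRate (q + 1) = 2 * (3 / 2) ^ (q + 1) := by simp [cumulRate]
  rw [cumulantBound, if_neg (by omega), Nat.add_sub_cancel, e1]
  unfold momentScale
  have hf : (0 : ℝ) < ((q + 2)! : ℝ) := by positivity
  have e2 : (((q + 2)! : ℝ) / 2) ^ (a + b + 2) * 2 ^ (a + b + 2) =
      ((q + 2)! : ℝ) ^ a * ((q + 2)! : ℝ) ^ b * ((q + 2)! : ℝ) ^ 2 := by
    rw [← Real.mul_rpow (by positivity) (by positivity), div_mul_cancel₀ _ two_ne_zero,
      Real.rpow_add hf, Real.rpow_add hf]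
    norm_num
  have h1 : ((q ! : ℕ) : ℝ) ^ a ≤ ((q + 2)! : ℝ) ^ a := by
    have : ((q ! : ℕ) : ℝ) ≤ ((q + 2)! : ℝ) := by
      exact_mod_cast Nat.factorial_le (by omega)
    gcongr
  have h2 : ((q : ℝ) + 1) * (((q + 1)! : ℝ) * (2 * (3 / 2) ^ (q + 1))) ≤
      3 / 4 * ((q + 2)! : ℝ) * κ ^ (q + 1) := by
    have h3 : (2 : ℝ) ^ (q + 1) ≤ κ ^ (q + 1) := by gcongr
    have h4 := three_pow_le q
    have e4 : (4 : ℝ) ^ (q + 1) = 2 ^ (q + 1) * 2 ^ (q + 1) := by rw [← mul_pow]; norm_num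
    have h5 : (0 : ℝ) < 2 ^ (q + 1) := by positivity
    have h6 : ((q : ℝ) + 1) * (2 * (3 / 2) ^ (q + 1)) ≤ 3 / 4 * (q + 2) * 2 ^ (q + 1) := by
      rw [e4] at h4
      rw [div_pow, mul_div, mul_div, div_le_iff₀ h5]
      linarith
    calc _ = ((q + 1)! : ℝ) * (((q : ℝ) + 1) * (2 * (3 / 2) ^ (q + 1))) := by ring
      _ ≤ ((q + 1)! : ℝ) * (3 / 4 * (q + 2) * κ ^ (q + 1)) := by
          exact mul_le_mul_of_nonneg_left (h6.trans (by gcongr)) (by positivity)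
      _ = _ := by
          rw [Nat.factorial_succ (q + 1)]; push_cast; ring
  calc _ = (n * ((q + 2)! : ℝ) ^ b * (K ^ 2 * M ^ (q + 2) * L₁ * L₂ ^ q) * ((q + 2)! : ℝ)) *
        (((q : ℝ) + 1) * (((q + 1)! : ℝ) * (2 * (3 / 2) ^ (q + 1)))) * ((q ! : ℕ) : ℝ) ^ a := by ring
    _ ≤ (n * ((q + 2)! : ℝ) ^ b * (K ^ 2 * M ^ (q + 2) * L₁ * L₂ ^ q) * ((q + 2)! : ℝ)) *
        (3 / 4 * ((q + 2)! : ℝ) * κ ^ (q + 1)) * ((q + 2)! : ℝ) ^ a := by gcongr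
    _ = 3 / 4 * (((q + 2)! : ℝ) ^ a * ((q + 2)! : ℝ) ^ b * ((q + 2)! : ℝ) ^ 2) *
        (K ^ 2 * M ^ 2 * L₁ * κ * n) * (M * L₂ * κ) ^ q := by ring
    _ = _ := by rw [← e2]; ring

theorem sum_abs_cumul_le {Ω : Type*} [MeasurableSpace Ω] {P : Measure Ω} [IsProbabilityMeasure P]
    {n : ℕ} {X : Fin n → Ω → ℝ} (hXmeas : ∀ i, Measurable (X i))
    (hXmean : ∀ i, ∫ ω, X i ω ∂P = 0)
    (τ : WeakDependenceType)
    (K M L₁ L₂ a b : ℝ) (hM : 0 < M) (hL₁ : 0 < L₁) (hL₂ : 0 < L₂)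
    (ha : 0 ≤ a) (hb : 0 ≤ b)
    (ρ : ℕ → ℝ) (hρ : Antitone ρ)
    (hcov : ∀ (u v : ℕ) (hu : 0 < u) (hv : 0 < v) (s : Fin u → Fin n) (t : Fin v → Fin n),
      Monotone s → Monotone t → s ⟨u - 1, Nat.sub_lt hu one_pos⟩ ≤ t ⟨0, hv⟩ →
      |cov[fun ω => ∏ i, X (s i) ω, fun ω => ∏ j, X (t j) ω; P]| ≤
        K ^ 2 * M ^ (u + v) * (((u + v)! : ℕ) : ℝ) ^ b * (τ.weight u v : ℝ) *
          ρ ((t ⟨0, hv⟩ : ℕ) - (s ⟨u - 1, Nat.sub_lt hu one_pos⟩ : ℕ)))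
    (hsum : ∀ k : ℕ, Summable (fun s : ℕ => ((s : ℝ) + 1) ^ k * ρ s) ∧
      ∑' s : ℕ, ((s : ℝ) + 1) ^ k * ρ s ≤ L₁ * L₂ ^ k * ((k ! : ℕ) : ℝ) ^ a)
    (hmom : ∀ (i : Fin n) (k : ℕ), Integrable (fun ω => |X i ω| ^ k) P ∧
      ∫ ω, |X i ω| ^ k ∂P ≤ ((k ! : ℕ) : ℝ) ^ b * M ^ k)
    {ι : Type*} [LinearOrder ι] [Fintype ι] [Nonempty ι] :
    ∑ t : ι → Fin n, |cumul (jointMoment P X t) Finset.univ| ≤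
      cumulantBound a b ((2 : ℝ) ^ (a + b + 2) * K ^ 2 * M ^ 2 * L₁ * max (K ^ 2) 2 * n)
        (M * L₂ * max (K ^ 2) 2) (Fintype.card ι) := by
  classical
  have hρ0 : ∀ s, 0 ≤ ρ s := by
    have h0 : Filter.Tendsto ρ Filter.atTop (nhds 0) := by
      have := (hsum 0).1.tendsto_atTop_zero
      simpa using this
    exact fun s => hρ.le_of_tendsto h0 s
  have hint : ∀ (i : Fin n) (k : ℕ), Integrable (fun ω => |X i ω| ^ k) P := fun i k => (hmom i k).1
  have hone : ∀ (t : ι → Fin n) A, jointMoment P X t A = 0 ∨ A.card ≠ 1 :=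
    fun t A => jointMoment_card_one hXmean t A
  have habs : ∀ (t : ι → Fin n) A, |jointMoment P X t A| ≤ momentScale b M A.card := fun t A =>
    abs_integral_prod_le A (by simp [momentScale]) (fun i => hint (t i)) fun i k => (hmom (t i) k).2
  obtain h1 | ⟨q, hq⟩ : Fintype.card ι = 1 ∨ ∃ q, Fintype.card ι = q + 2 := by
    have := Fintype.card_pos (α := ι)
    rcases eq_or_ne (Fintype.card ι) 1 with h | h
    · exact Or.inl h
    · exact Or.inr ⟨Fintype.card ι - 2, by omega⟩
  · rw [h1, cumulantBound, if_pos le_rfl]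
    refine (Finset.sum_eq_zero fun t _ => ?_).le
    have hne : (Finset.univ : Finset ι).Nonempty := Finset.univ_nonempty
    have he : (Finset.univ : Finset ι).erase (Finset.univ.min' hne) = ∅ := by
      rw [← Finset.card_eq_zero, Finset.card_erase_of_mem (Finset.mem_univ _), Finset.card_univ, h1]
    rw [cumul_eq _ hne, he]
    rcases hone t Finset.univ with h | h
    · simp [h, Finset.ssubsets]
    · exact absurd (by rw [Finset.card_univ, h1]) h
  set c := ((q + 1)! : ℝ) * cumulRate (q + 1) * (K ^ 2 * momentScale b M (q + 2)) with hc
  have hc0 : 0 ≤ c := mul_nonneg (mul_nonneg (by positivity) (cumulRate_nonneg _))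
    (mul_nonneg (by positivity) (momentScale_nonneg hM _ _))
  have hgap := sum_le_of_gap hq (fun r => c * ρ r) (fun s => mul_nonneg hc0 (hρ0 s))
    (fun t => |cumul (jointMoment P X t) Finset.univ|) (fun t U hU hU' r hr => ?_)
  · refine hgap.trans ?_
    have hS : ∑ s ∈ Finset.range n, ((s : ℝ) + 1) ^ q * ρ s ≤ L₁ * L₂ ^ q * ((q ! : ℕ) : ℝ) ^ a :=
      ((hsum q).1.sum_le_tsum _ fun s _ => mul_nonneg (by positivity) (hρ0 s)).trans (hsum q).2
    have e1 : ∑ s ∈ Finset.range n, ((s : ℝ) + 1) ^ q * (c * ρ s) =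
        c * ∑ s ∈ Finset.range n, ((s : ℝ) + 1) ^ q * ρ s := by
      rw [Finset.mul_sum]
      exact Finset.sum_congr rfl fun s _ => by ring
    rw [e1, hq]
    refine le_trans ?_ (cumulant_constant_le hM hL₁ hL₂ ha n q)
    gcongr
  · have h := abs_cumul_le_of_split (jointMoment P X t) (jointMoment_empty t) (momentScale b M)
      (momentScale_nonneg hM b) (momentScale_mul_le hM hb)
      (Q := K ^ 2 * ρ r) (mul_nonneg (by positivity) (hρ0 r)) (hone t) (habs t) U
      (fun A hA1 hA2 => abs_jointMoment_sub_le hXmeas τ K M b hM ρ hρ hcov hρ0 hint t U r hr A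
        hA1 hA2) (A := Finset.univ)
      (by obtain ⟨x, hx⟩ := hU; exact ⟨x, by simpa using hx⟩)
      (by obtain ⟨x, hx⟩ := hU'; exact ⟨x, by simpa using hx⟩)
    rw [Finset.card_univ, hq, show q + 2 - 1 = q + 1 by omega] at h
    refine h.trans (le_of_eq ?_)
    rw [hc]; ring

theorem sum_triangle_le (u v : ℕ → ℝ) (hu : ∀ k, 0 ≤ u k) (hv : ∀ k, 0 ≤ v k) (N : ℕ) :
    ∑ k ∈ Finset.range N, ∑ j ∈ Finset.range (k + 1), u j * v (k - j) ≤
      (∑ j ∈ Finset.range N, u j) * ∑ k ∈ Finset.range (N + 1), v k := by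
  rw [Finset.sum_range_diag_flip N fun j i => u j * v i, Finset.sum_mul]
  refine Finset.sum_le_sum fun j _ => ?_
  rw [← Finset.mul_sum]
  refine mul_le_mul_of_nonneg_left ?_ (hu j)
  exact Finset.sum_le_sum_of_subset_of_nonneg
    (Finset.range_subset_range.2 (by omega)) fun i _ _ => hv i

/-- Partial sums of a sequence satisfying the moment-cumulant inequality. -/
theorem sum_le_exp_sum_of_recursion (a g : ℕ → ℝ) (ha : ∀ k, 0 ≤ a k) (hg : ∀ k, 0 ≤ g k)
    (h0 : a 0 ≤ 1)
    (h : ∀ k : ℕ, ((k : ℝ) + 1) * a (k + 1) ≤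
      ∑ j ∈ Finset.range (k + 1), (((j : ℝ) + 1) * g (j + 1)) * a (k - j)) (N : ℕ) :
    ∑ k ∈ Finset.range (N + 1), a k ≤ Real.exp (∑ j ∈ Finset.range N, g (j + 1)) := by
  let p : ℝ → ℝ := fun t => ∑ k ∈ Finset.range (N + 1), a k * t ^ k
  let q : ℝ → ℝ := fun t => ∑ j ∈ Finset.range N, g (j + 1) * t ^ (j + 1)
  let p' : ℝ → ℝ := fun t => ∑ k ∈ Finset.range N, a (k + 1) * (((k : ℝ) + 1) * t ^ k)
  let q' : ℝ → ℝ := fun t => ∑ j ∈ Finset.range N, g (j + 1) * (((j : ℝ) + 1) * t ^ j)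
  have hp : ∀ t, HasDerivAt p (p' t) t := by
    intro t
    have h1 : p = fun t => ∑ k ∈ Finset.range N, a (k + 1) * t ^ (k + 1) + a 0 := by
      funext t
      simp only [p]
      rw [Finset.sum_range_succ']
      simp
    rw [h1]
    refine HasDerivAt.add_const _ (HasDerivAt.fun_sum fun k _ => ?_)
    have := (hasDerivAt_pow (k + 1) t).const_mul (a (k + 1))
    simpa using this
  have hq : ∀ t, HasDerivAt q (q' t) t := by
    intro t
    refine HasDerivAt.fun_sum fun k _ => ?_
    have := (hasDerivAt_pow (k + 1) t).const_mul (g (k + 1))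
    simpa using this
  have hF : ∀ t, HasDerivAt (fun t => p t * Real.exp (-q t))
      ((p' t - q' t * p t) * Real.exp (-q t)) t := by
    intro t
    refine ((hp t).mul (hq t).neg.exp).congr_deriv ?_
    simp only [Pi.neg_apply]
    ring
  have hle : ∀ t, 0 ≤ t → p' t ≤ q' t * p t := by
    intro t ht
    have h1 : p' t ≤ ∑ k ∈ Finset.range N, ∑ j ∈ Finset.range (k + 1),
        (g (j + 1) * (((j : ℝ) + 1) * t ^ j)) * (a (k - j) * t ^ (k - j)) := by
      refine Finset.sum_le_sum fun k _ => ?_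
      calc a (k + 1) * (((k : ℝ) + 1) * t ^ k) = (((k : ℝ) + 1) * a (k + 1)) * t ^ k := by ring
        _ ≤ (∑ j ∈ Finset.range (k + 1), (((j : ℝ) + 1) * g (j + 1)) * a (k - j)) * t ^ k :=
            mul_le_mul_of_nonneg_right (h k) (by positivity)
        _ = _ := by
            rw [Finset.sum_mul]
            refine Finset.sum_congr rfl fun j hj => ?_
            have hj := Finset.mem_range.1 hj
            have : t ^ k = t ^ j * t ^ (k - j) := by rw [← pow_add]; congr 1; omega
            rw [this]; ring
    exact h1.trans (sum_triangle_le _ (fun k => a k * t ^ k)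
      (fun k => mul_nonneg (hg _) (by positivity)) (fun k => mul_nonneg (ha _) (by positivity)) N)
  have hanti : AntitoneOn (fun t => p t * Real.exp (-q t)) (Set.Ici 0) := by
    refine antitoneOn_of_deriv_nonpos (convex_Ici 0)
      (fun t _ => (hF t).continuousAt.continuousWithinAt)
      (fun t _ => (hF t).differentiableAt.differentiableWithinAt) fun t ht => ?_
    rw [interior_Ici] at ht
    rw [(hF t).deriv]
    exact mul_nonpos_of_nonpos_of_nonneg (sub_nonpos.2 (hle t (le_of_lt ht))) (Real.exp_pos _).le
  have h01 := hanti (Set.mem_Ici.2 le_rfl) (Set.mem_Ici.2 zero_le_one) zero_le_one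
  have hp0 : p 0 = a 0 := by
    simp only [p]
    rw [Finset.sum_range_succ']
    simp
  have hq0 : q 0 = 0 := by simp [q]
  have hp1 : p 1 = ∑ k ∈ Finset.range (N + 1), a k := by simp [p]
  have hq1 : q 1 = ∑ j ∈ Finset.range N, g (j + 1) := by simp [q]
  simp only [hp0, hq0, hp1, hq1, neg_zero, Real.exp_zero, mul_one, Real.exp_neg] at h01
  rw [← div_eq_mul_inv, div_le_iff₀ (Real.exp_pos _)] at h01
  nlinarith [Real.exp_pos (∑ j ∈ Finset.range N, g (j + 1))]

/-- The exponential series truncated after the term of degree `N`. -/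
noncomputable def truncExp (N : ℕ) (x : ℝ) : ℝ := ∑ k ∈ Finset.range (N + 1), x ^ k / (k ! : ℝ)

theorem hasDerivAt_truncExp (N : ℕ) (x : ℝ) :
    HasDerivAt (truncExp (N + 1)) (truncExp N x) x := by
  have h1 : truncExp (N + 1) = fun x => ∑ k ∈ Finset.range (N + 1), x ^ (k + 1) / ((k + 1)! : ℝ) + 1 := by
    funext x
    simp only [truncExp]
    rw [Finset.sum_range_succ']
    simp
  rw [h1]
  refine HasDerivAt.add_const _ (HasDerivAt.fun_sum fun k _ => ?_)
  have := (hasDerivAt_pow (k + 1) x).div_const ((k + 1)! : ℝ)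
  refine this.congr_deriv ?_
  rw [Nat.factorial_succ]
  push_cast
  have h2 : (k : ℝ) + 1 ≠ 0 := by positivity
  have h3 : (k ! : ℝ) ≠ 0 := by positivity
  field_simp

theorem truncExp_neg_sub_exp_neg_nonneg (N : ℕ) {t : ℝ} (ht : 0 ≤ t) :
    0 ≤ (-1) ^ N * (truncExp N (-t) - Real.exp (-t)) := by
  induction N generalizing t with
  | zero =>
    have := Real.exp_le_one_iff.2 (neg_nonpos.2 ht)
    simp [truncExp]
    linarith
  | succ N ih =>
    have hd : ∀ t, HasDerivAt (fun t => (-1) ^ (N + 1) * (truncExp (N + 1) (-t) - Real.exp (-t)))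
        ((-1) ^ N * (truncExp N (-t) - Real.exp (-t))) t := by
      intro t
      have h1 := ((hasDerivAt_truncExp N (-t)).comp t (hasDerivAt_neg t)).sub (hasDerivAt_neg t).exp
      refine (h1.const_mul ((-1 : ℝ) ^ (N + 1))).congr_deriv ?_
      ring
    have hmono := monotoneOn_of_deriv_nonneg (convex_Ici (0 : ℝ))
      (fun t _ => (hd t).continuousAt.continuousWithinAt)
      (fun t _ => (hd t).differentiableAt.differentiableWithinAt) (fun t ht => by
        rw [interior_Ici] at ht
        rw [(hd t).deriv]
        exact ih (le_of_lt ht))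
    have h0 := hmono (Set.mem_Ici.2 le_rfl) (Set.mem_Ici.2 ht) ht
    refine le_trans (le_of_eq ?_) h0
    simp [truncExp, Finset.sum_range_succ']

theorem truncExp_mono (N : ℕ) {x y : ℝ} (hx : 0 ≤ x) (hxy : x ≤ y) : truncExp N x ≤ truncExp N y := by
  unfold truncExp
  gcongr

theorem one_le_truncExp (N : ℕ) {x : ℝ} (hx : 0 ≤ x) : 1 ≤ truncExp N x := by
  refine le_trans (le_of_eq ?_) (truncExp_mono N le_rfl hx)
  simp [truncExp, Finset.sum_range_succ']

theorem truncExp_nonneg {N : ℕ} (hN : Even N) (x : ℝ) : 0 ≤ truncExp N x := by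
  rcases le_total 0 x with hx | hx
  · exact zero_le_one.trans (one_le_truncExp N hx)
  · have h := truncExp_neg_sub_exp_neg_nonneg N (neg_nonneg.2 hx)
    rw [hN.neg_one_pow, neg_neg] at h
    have := Real.exp_pos x
    linarith

theorem exp_le_two_mul_truncExp {N : ℕ} {y : ℝ} (hN : 9 ≤ N) (hy : 0 < y) (hNy : 3 / 2 * y ≤ N + 1) :
    Real.exp y ≤ 2 * truncExp N y := by
  have hterm : ∀ i : ℕ, y ^ (i + (N + 1)) / ((i + (N + 1))! : ℝ) ≤
      (y ^ N / (N ! : ℝ)) * (2 / 3) * (2 / 3) ^ i := by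
    intro i
    induction i with
    | zero =>
      rw [zero_add, pow_succ, Nat.factorial_succ]
      push_cast
      rw [pow_zero, mul_one]
      have : (0 : ℝ) < N ! := by positivity
      have h2 : y / ((N : ℝ) + 1) ≤ 2 / 3 := by rw [div_le_iff₀ (by positivity)]; linarith
      calc _ = y ^ N / (N ! : ℝ) * (y / (N + 1)) := by field_simp
        _ ≤ _ := by gcongr
    | succ i ih =>
      rw [show i + 1 + (N + 1) = (i + (N + 1)) + 1 by ring, pow_succ, Nat.factorial_succ]
      push_cast
      have h2 : y / ((i : ℝ) + (N + 1) + 1) ≤ 2 / 3 := by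
        rw [div_le_iff₀ (by positivity)]
        have : (0 : ℝ) ≤ i := by positivity
        linarith
      have : (0 : ℝ) < (i + (N + 1))! := by positivity
      calc _ = y ^ (i + (N + 1)) / ((i + (N + 1))! : ℝ) * (y / ((i : ℝ) + (N + 1) + 1)) := by field_simp
        _ ≤ (y ^ N / (N ! : ℝ)) * (2 / 3) * (2 / 3) ^ i * (2 / 3) := by gcongr
        _ = _ := by ring
  have hs := NormedSpace.expSeries_div_summable (𝔸 := ℝ) y
  have hexp : Real.exp y = ∑' k : ℕ, y ^ k / (k ! : ℝ) := by
    rw [Real.exp_eq_exp_ℝ, NormedSpace.exp_eq_tsum_div]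
  have hgeo : Summable fun i : ℕ => (y ^ N / (N ! : ℝ)) * (2 / 3) * (2 / 3 : ℝ) ^ i :=
    (summable_geometric_of_lt_one (by norm_num) (by norm_num)).mul_left _
  have htail : ∑' i : ℕ, y ^ (i + (N + 1)) / ((i + (N + 1))! : ℝ) ≤ 2 * (y ^ N / (N ! : ℝ)) := by
    refine (((summable_nat_add_iff (N + 1)).2 hs).tsum_le_tsum hterm hgeo).trans (le_of_eq ?_)
    rw [tsum_mul_left, tsum_geometric_of_lt_one (by norm_num) (by norm_num)]
    ring
  have hsplit := hs.sum_add_tsum_nat_add (N + 1)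
  rw [hexp, ← hsplit]
  have hhead : 2 * (y ^ N / (N ! : ℝ)) ≤ truncExp N y := by
    obtain ⟨m, rfl⟩ : ∃ m, N = m + 1 := ⟨N - 1, by omega⟩
    unfold truncExp
    rw [Finset.sum_range_succ, Finset.sum_range_succ]
    have hsum : 0 ≤ ∑ k ∈ Finset.range m, y ^ k / (k ! : ℝ) :=
      Finset.sum_nonneg fun _ _ => by positivity
    have hm : (8 : ℝ) ≤ m := by exact_mod_cast (by omega : 8 ≤ m)
    have h3 : y ^ (m + 1) / ((m + 1)! : ℝ) ≤ y ^ m / (m ! : ℝ) := by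
      rw [pow_succ, Nat.factorial_succ]
      push_cast at hNy ⊢
      have : (0 : ℝ) < m ! := by positivity
      have h2 : y / ((m : ℝ) + 1) ≤ 1 := by
        rw [div_le_iff₀ (by positivity)]; linarith
      calc _ = y ^ m / (m ! : ℝ) * (y / (m + 1)) := by field_simp
        _ ≤ y ^ m / (m ! : ℝ) * 1 := by gcongr
        _ = _ := mul_one _
    linarith
  have : truncExp N y = ∑ i ∈ Finset.range (N + 1), y ^ i / (i ! : ℝ) := rfl
  linarith

theorem half_factorial_le {k : ℕ} (hk : 12 ≤ k) :
    (k ! : ℝ) / 2 ≤ (2 * ((k : ℝ) - 1) / 3) ^ (k - 2) := by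
  induction k, hk using Nat.le_induction with
  | base => norm_num [Nat.factorial]
  | succ k hk ih =>
    obtain ⟨m, rfl⟩ : ∃ m, k = m + 2 := ⟨k - 2, by omega⟩
    have hm : (10 : ℝ) ≤ m := by exact_mod_cast (by omega : 10 ≤ m)
    rw [show m + 2 + 1 - 2 = m + 1 by omega, Nat.factorial_succ]
    rw [show m + 2 - 2 = m by omega] at ih
    push_cast at ih ⊢
    have hb := one_add_mul_le_pow (a := 1 / ((m : ℝ) + 1)) (by
      have : (0 : ℝ) < 1 / ((m : ℝ) + 1) := by positivity
      linarith) m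
    have e1 : (2 * ((m : ℝ) + 2 + 1 - 1) / 3) ^ (m + 1) =
        (2 * ((m : ℝ) + 2 - 1) / 3) ^ m * (1 + 1 / ((m : ℝ) + 1)) ^ m * (2 * (m + 2) / 3) := by
      rw [pow_succ, ← mul_pow]
      congr 1
      · congr 1
        field_simp
        ring
      · ring
    have h3 : (m : ℝ) + 2 + 1 ≤ (1 + m * (1 / ((m : ℝ) + 1))) * (2 * (m + 2) / 3) := by
      rw [mul_one_div, one_add_div (by positivity), div_mul_div_comm, le_div_iff₀ (by positivity)]
      nlinarith
    have h0 : (0 : ℝ) ≤ 2 * ((m : ℝ) + 2 - 1) / 3 := by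
      have : (0 : ℝ) ≤ (m : ℝ) + 2 - 1 := by linarith
      positivity
    rw [e1]
    calc ((m : ℝ) + 2 + 1) * ((m + 2)! : ℝ) / 2 = ((m + 2)! : ℝ) / 2 * (m + 2 + 1) := by ring
      _ ≤ (2 * ((m : ℝ) + 2 - 1) / 3) ^ m *
          ((1 + m * (1 / ((m : ℝ) + 1))) * (2 * (m + 2) / 3)) := by gcongr
      _ ≤ (2 * ((m : ℝ) + 2 - 1) / 3) ^ m *
          ((1 + 1 / ((m : ℝ) + 1)) ^ m * (2 * (m + 2) / 3)) := by gcongr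
      _ = _ := by ring

theorem exp_le_truncExp_six_of_mem {l y : ℝ} {j : ℕ} (C : ℝ) (hl : 0 ≤ l) (hly : l ≤ y)
    (hyr : y ≤ j / 7) (hC : 0 ≤ C) (hexp : 2.7182818286 ^ j ≤ C ^ 8) (hT : C ≤ truncExp 6 l) :
    Real.exp (7 / 8 * y) ≤ truncExp 6 y := by
  have h1 : Real.exp (7 / 8 * y) ≤ C := by
    refine le_of_pow_le_pow_left₀ (n := 8) (by norm_num) hC ?_
    rw [← Real.exp_nat_mul]
    calc Real.exp ((8 : ℕ) * (7 / 8 * y)) ≤ Real.exp (j * 1) := by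
          refine Real.exp_le_exp.2 ?_
          push_cast
          linarith
      _ = Real.exp 1 ^ j := Real.exp_nat_mul _ _
      _ ≤ 2.7182818286 ^ j := pow_le_pow_left₀ (Real.exp_pos _).le exp_one_le j
      _ ≤ _ := hexp
  exact h1.trans (hT.trans (truncExp_mono 6 hl hly))

theorem truncExp_six (x : ℝ) : truncExp 6 x =
    1 + x + x ^ 2 / 2 + x ^ 3 / 6 + x ^ 4 / 24 + x ^ 5 / 120 + x ^ 6 / 720 := by
  simp [truncExp, Finset.sum_range_succ, Nat.factorial]

theorem exp_le_truncExp_six {y : ℝ} (h1 : 3.4 ≤ y) (h2 : y ≤ 6.5) :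
    Real.exp (7 / 8 * y) ≤ truncExp 6 y := by
  rcases le_total y (26 / 7) with h | h
  · exact exp_le_truncExp_six_of_mem (l := 3.4) (j := 26) 28.2 (by norm_num) h1
      (by exact_mod_cast h) (by norm_num) (by norm_num) (by rw [truncExp_six]; norm_num)
  clear h1; rename 26 / 7 ≤ y => h1
  rcases le_total y (29 / 7) with h | h
  · exact exp_le_truncExp_six_of_mem (j := 29) 37.62 (by norm_num) h1
      (by exact_mod_cast h) (by norm_num) (by norm_num) (by rw [truncExp_six]; norm_num)
  clear h1; rename 29 / 7 ≤ y => h1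
  rcases le_total y (32 / 7) with h | h
  · exact exp_le_truncExp_six_of_mem (j := 32) 55.04 (by norm_num) h1
      (by exact_mod_cast h) (by norm_num) (by norm_num) (by rw [truncExp_six]; norm_num)
  clear h1; rename 32 / 7 ≤ y => h1
  rcases le_total y (34 / 7) with h | h
  · exact exp_le_truncExp_six_of_mem (j := 34) 79.45 (by norm_num) h1
      (by exact_mod_cast h) (by norm_num) (by norm_num) (by rw [truncExp_six]; norm_num)
  clear h1; rename 34 / 7 ≤ y => h1
  rcases le_total y (36 / 7) with h | h
  · exact exp_le_truncExp_six_of_mem (j := 36) 100.7 (by norm_num) h1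
      (by exact_mod_cast h) (by norm_num) (by norm_num) (by rw [truncExp_six]; norm_num)
  clear h1; rename 36 / 7 ≤ y => h1
  rcases le_total y (38 / 7) with h | h
  · exact exp_le_truncExp_six_of_mem (j := 38) 126.8 (by norm_num) h1
      (by exact_mod_cast h) (by norm_num) (by norm_num) (by rw [truncExp_six]; norm_num)
  clear h1; rename 38 / 7 ≤ y => h1
  rcases le_total y (40 / 7) with h | h
  · exact exp_le_truncExp_six_of_mem (j := 40) 158.8 (by norm_num) h1
      (by exact_mod_cast h) (by norm_num) (by norm_num) (by rw [truncExp_six]; norm_num)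
  clear h1; rename 40 / 7 ≤ y => h1
  rcases le_total y (42 / 7) with h | h
  · exact exp_le_truncExp_six_of_mem (j := 42) 197.6 (by norm_num) h1
      (by exact_mod_cast h) (by norm_num) (by norm_num) (by rw [truncExp_six]; norm_num)
  clear h1; rename 42 / 7 ≤ y => h1
  rcases le_total y (43 / 7) with h | h
  · exact exp_le_truncExp_six_of_mem (j := 43) 244.6 (by norm_num) h1
      (by exact_mod_cast h) (by norm_num) (by norm_num) (by rw [truncExp_six]; norm_num)
  clear h1; rename 43 / 7 ≤ y => h1
  rcases le_total y (44 / 7) with h | h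
  · exact exp_le_truncExp_six_of_mem (j := 44) 271.4 (by norm_num) h1
      (by exact_mod_cast h) (by norm_num) (by norm_num) (by rw [truncExp_six]; norm_num)
  clear h1; rename 44 / 7 ≤ y => h1
  rcases le_total y (45 / 7) with h | h
  · exact exp_le_truncExp_six_of_mem (j := 45) 300.9 (by norm_num) h1
      (by exact_mod_cast h) (by norm_num) (by norm_num) (by rw [truncExp_six]; norm_num)
  · exact exp_le_truncExp_six_of_mem (j := 46) 333 (by norm_num) h
      (by push_cast; linarith) (by norm_num) (by norm_num) (by rw [truncExp_six]; norm_num)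

/-- A truncation order for which the exponential series is nearly exact while the factorials
are still dominated by powers. -/
theorem exists_truncation {y Y : ℝ} (hy : 3.4 ≤ y) (hyY : y ≤ Y) (hY : 4.4 ≤ Y) :
    ∃ N : ℕ, Even N ∧ (∀ q : ℕ, q + 2 ≤ N → ((q + 2)! : ℝ) / 2 ≤ Y ^ q) ∧
      Real.exp (7 / 8 * y) ≤ truncExp N y := by
  rcases le_total y 6.5 with h | h
  · refine ⟨6, ⟨3, rfl⟩, fun q hq => ?_, exp_le_truncExp_six hy h⟩
    have hp : (4.4 : ℝ) ^ q ≤ Y ^ q := pow_le_pow_left₀ (by norm_num) hY q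
    refine le_trans ?_ hp
    have hq : q ≤ 4 := by omega
    interval_cases q <;> norm_num [Nat.factorial]
  · have hz : 0 ≤ (3 / 2 * y - 1) / 2 := by linarith
    set m := ⌈(3 / 2 * y - 1) / 2⌉₊ with hm
    have h1 : (3 / 2 * y - 1) / 2 ≤ m := Nat.le_ceil _
    have h2 : (m : ℝ) < (3 / 2 * y - 1) / 2 + 1 := Nat.ceil_lt_add_one hz
    have hm5 : 5 ≤ m := by
      have : (4 : ℝ) < m := by linarith
      exact_mod_cast this
    refine ⟨m + m, ⟨m, rfl⟩, fun q hq => ?_, ?_⟩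
    · rcases Nat.lt_or_ge q 10 with hq' | hq'
      · have hp : (6.5 : ℝ) ^ q ≤ Y ^ q := pow_le_pow_left₀ (by norm_num) (h.trans hyY) q
        refine le_trans ?_ hp
        interval_cases q <;> norm_num [Nat.factorial]
      · have h3 := half_factorial_le (k := q + 2) (by omega)
        rw [Nat.add_sub_cancel] at h3
        refine h3.trans (pow_le_pow_left₀ ?_ ?_ q)
        · push_cast
          have : (0 : ℝ) ≤ q := by positivity
          linarith
        · have h4 : ((q + 2 : ℕ) : ℝ) ≤ ((m + m : ℕ) : ℝ) := by exact_mod_cast hq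
          push_cast at h4 ⊢
          linarith
    · have h3 := exp_le_two_mul_truncExp (N := m + m) (y := y) (by omega) (by linarith)
        (by push_cast; linarith)
      have h4 : 2 ≤ Real.exp (y / 8) := by
        have h5 := Real.quadratic_le_exp_of_nonneg (x := 13 / 16) (by norm_num)
        have h6 : Real.exp (13 / 16) ≤ Real.exp (y / 8) := Real.exp_le_exp.2 (by linarith)
        norm_num at h5
        linarith
      have h5 : Real.exp y = Real.exp (7 / 8 * y) * Real.exp (y / 8) := by
        rw [← Real.exp_add]; congr 1; ring
      have h6 := Real.exp_pos (7 / 8 * y)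
      nlinarith

theorem exp_half_le_of_le {y : ℝ} (h0 : 0 ≤ y) (h1 : y ≤ 3.4) : Real.exp (y / 2) ≤ 1 + 4 / 3 * y := by
  have ha : 0 ≤ 1 - y / 3.4 := by
    rw [sub_nonneg, div_le_one (by norm_num)]; exact h1
  have hb : 0 ≤ y / 3.4 := by positivity
  have hc := convexOn_exp.2 (Set.mem_univ (0 : ℝ)) (Set.mem_univ (1.7 : ℝ)) ha hb (by ring)
  have he : Real.exp 1.7 ≤ 5.5 := by
    refine le_of_pow_le_pow_left₀ (n := 10) (by norm_num) (by norm_num) ?_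
    rw [← Real.exp_nat_mul]
    calc Real.exp ((10 : ℕ) * 1.7) = Real.exp 1 ^ 17 := by
          rw [← Real.exp_nat_mul]; norm_num
      _ ≤ 2.7182818286 ^ 17 := pow_le_pow_left₀ (Real.exp_pos _).le exp_one_le _
      _ ≤ _ := by norm_num
  simp only [smul_eq_mul, mul_zero, zero_add, Real.exp_zero, mul_one] at hc
  have e1 : y / 3.4 * 1.7 = y / 2 := by ring
  rw [e1] at hc
  have : y / 3.4 * Real.exp 1.7 ≤ y / 3.4 * 5.5 := by gcongr
  norm_num at hc this ⊢
  linarith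

/-- Cantelli's inequality. -/
theorem cantelli {Ω : Type*} [MeasurableSpace Ω] {P : Measure Ω} [IsProbabilityMeasure P]
    {S : Ω → ℝ} (hS : MemLp S 2 P) (hmean : ∫ ω, S ω ∂P = 0) {V x : ℝ} (hV : 0 ≤ V)
    (hvar : ∫ ω, S ω ^ 2 ∂P ≤ V) (hx : 0 < x) :
    P.real {ω | x ≤ S ω} ≤ V / (V + x ^ 2) := by
  have h1 : Integrable S P := hS.integrable (by norm_num)
  have h2 : Integrable (fun ω => S ω ^ 2) P := hS.integrable_sq
  set c := V / x with hc
  have hc0 : 0 ≤ c := by positivity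
  have hint : Integrable (fun ω => (S ω + c) ^ 2) P := by
    have : (fun ω => (S ω + c) ^ 2) = fun ω => S ω ^ 2 + 2 * c * S ω + c ^ 2 := by
      funext ω; ring
    rw [this]
    exact (h2.add (h1.const_mul _)).add (integrable_const _)
  have hE : ∫ ω, (S ω + c) ^ 2 ∂P ≤ V + c ^ 2 := by
    have : (fun ω => (S ω + c) ^ 2) = fun ω => S ω ^ 2 + 2 * c * S ω + c ^ 2 := by
      funext ω; ring
    rw [this, integral_add (by exact h2.add (h1.const_mul _)) (integrable_const _),
      integral_add h2 (h1.const_mul _), integral_const_mul, hmean]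
    simp
    linarith
  have hM := mul_meas_ge_le_integral_of_nonneg
    (Filter.Eventually.of_forall fun ω => sq_nonneg (S ω + c)) hint ((x + c) ^ 2)
  have hsub : P.real {ω | x ≤ S ω} ≤ P.real {ω | (x + c) ^ 2 ≤ (S ω + c) ^ 2} := by
    refine measureReal_mono fun ω hω => ?_
    have hω : x ≤ S ω := hω
    show (x + c) ^ 2 ≤ (S ω + c) ^ 2
    gcongr
  have hpos : 0 < (x + c) ^ 2 := by positivity
  calc P.real {ω | x ≤ S ω} ≤ (V + c ^ 2) / (x + c) ^ 2 := by
        rw [le_div_iff₀ hpos]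
        nlinarith
    _ = V / (V + x ^ 2) := by
        rw [hc]
        field_simp
        ring

theorem cumulantBound_nonneg {a b H δ : ℝ} (hH : 0 ≤ H) (hδ : 0 ≤ δ) (k : ℕ) :
    0 ≤ cumulantBound a b H δ k := by
  unfold cumulantBound
  split_ifs
  · exact le_rfl
  · positivity

section Tail

variable {Ω : Type*} [MeasurableSpace Ω] {P : Measure Ω} [IsProbabilityMeasure P] {S : Ω → ℝ}

theorem integrable_pow_of_memLp (hL : ∀ p : ℕ, MemLp S p P) (k : ℕ) :
    Integrable (fun ω => S ω ^ k) P := by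
  rcases Nat.eq_zero_or_pos k with rfl | hk
  · simp
  · have h := (hL k).integrable_norm_pow hk.ne'
    refine h.mono ((hL k).aestronglyMeasurable.pow k) (Filter.Eventually.of_forall fun ω => ?_)
    simp

theorem measureReal_ge_le_truncExp (hL : ∀ p : ℕ, MemLp S p P) {N : ℕ} (hN : Even N) {h x : ℝ}
    (hh : 0 ≤ h) (hx : 0 ≤ x) :
    P.real {ω | x ≤ S ω} * truncExp N (h * x) ≤
      ∑ k ∈ Finset.range (N + 1), h ^ k * |∫ ω, S ω ^ k ∂P| / (k ! : ℝ) := by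
  have hterm : ∀ k ∈ Finset.range (N + 1), Integrable (fun ω => (h * S ω) ^ k / (k ! : ℝ)) P := by
    intro k _
    have := ((integrable_pow_of_memLp hL k).const_mul (h ^ k)).div_const (k ! : ℝ)
    simpa only [mul_pow] using this
  have hint : Integrable (fun ω => truncExp N (h * S ω)) P := by
    unfold truncExp
    exact integrable_finsetSum _ hterm
  have hM := mul_meas_ge_le_integral_of_nonneg
    (Filter.Eventually.of_forall fun ω => truncExp_nonneg hN (h * S ω)) hint (truncExp N (h * x))
  have hsub : P.real {ω | x ≤ S ω} ≤ P.real {ω | truncExp N (h * x) ≤ truncExp N (h * S ω)} := by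
    refine measureReal_mono fun ω hω => ?_
    have hω : x ≤ S ω := hω
    exact truncExp_mono N (by positivity) (by gcongr)
  calc P.real {ω | x ≤ S ω} * truncExp N (h * x)
      ≤ truncExp N (h * x) * P.real {ω | truncExp N (h * x) ≤ truncExp N (h * S ω)} := by
        rw [mul_comm]
        exact mul_le_mul_of_nonneg_left hsub (truncExp_nonneg hN _)
    _ ≤ _ := hM
    _ = ∑ k ∈ Finset.range (N + 1), ∫ ω, (h * S ω) ^ k / (k ! : ℝ) ∂P := by
        unfold truncExp
        exact integral_finsetSum _ hterm
    _ ≤ _ := by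
        refine Finset.sum_le_sum fun k _ => ?_
        rw [integral_div]
        gcongr
        simp only [mul_pow]
        rw [integral_const_mul]
        exact mul_le_mul_of_nonneg_left (le_abs_self _) (by positivity)

theorem sum_moment_le_exp (G : ℕ → ℝ) (hG : ∀ k, 0 ≤ G k) {h : ℝ} (hh : 0 ≤ h)
    (hrec : ∀ k : ℕ, |∫ ω, S ω ^ (k + 1) ∂P| ≤ ∑ c ∈ Finset.range (k + 1),
      (k.choose c : ℝ) * (G (c + 1) * |∫ ω, S ω ^ (k - c) ∂P|)) (N : ℕ) :
    ∑ k ∈ Finset.range (N + 1), h ^ k * |∫ ω, S ω ^ k ∂P| / (k ! : ℝ) ≤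
      Real.exp (∑ j ∈ Finset.range N, h ^ (j + 1) * G (j + 1) / ((j + 1)! : ℝ)) := by
  refine sum_le_exp_sum_of_recursion (fun k => h ^ k * |∫ ω, S ω ^ k ∂P| / (k ! : ℝ))
    (fun k => h ^ k * G k / (k ! : ℝ)) (fun k => by positivity)
    (fun k => by have := hG k; positivity) (by simp) (fun k => ?_) N
  have hk : (0 : ℝ) < k ! := by positivity
  calc ((k : ℝ) + 1) * (h ^ (k + 1) * |∫ ω, S ω ^ (k + 1) ∂P| / ((k + 1)! : ℝ))
      = h ^ (k + 1) / (k ! : ℝ) * |∫ ω, S ω ^ (k + 1) ∂P| := by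
        rw [Nat.factorial_succ]; push_cast; field_simp
    _ ≤ h ^ (k + 1) / (k ! : ℝ) * ∑ c ∈ Finset.range (k + 1),
        (k.choose c : ℝ) * (G (c + 1) * |∫ ω, S ω ^ (k - c) ∂P|) := by
        gcongr
        exact hrec k
    _ = _ := by
        rw [Finset.mul_sum]
        refine Finset.sum_congr rfl fun c hc => ?_
        have hc : c ≤ k := by have := Finset.mem_range.1 hc; omega
        have h1 : (k.choose c : ℝ) * (c ! : ℝ) * ((k - c)! : ℝ) = (k ! : ℝ) := by
          exact_mod_cast Nat.choose_mul_factorial_mul_factorial hc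
        have h2 : h ^ (k + 1) = h ^ (c + 1) * h ^ (k - c) := by
          rw [← pow_add]; congr 1; omega
        have h3 : (0 : ℝ) < c ! := by positivity
        have h4 : (0 : ℝ) < (k - c)! := by positivity
        have h5 : (0 : ℝ) < k.choose c := by exact_mod_cast Nat.choose_pos hc
        rw [h2, ← h1, Nat.factorial_succ]
        push_cast
        field_simp

/-- Tail estimate for a random variable with factorially growing cumulant bounds. -/
theorem measureReal_ge_le_of_cumulantBound (hL : ∀ p : ℕ, MemLp S p P) {a b H δ x : ℝ}
    (ha : 0 ≤ a) (hb : 0 ≤ b) (hH : 0 < H) (hδ : 0 < δ) (hx : 0 < x)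
    (hrec : ∀ k : ℕ, |∫ ω, S ω ^ (k + 1) ∂P| ≤ ∑ c ∈ Finset.range (k + 1),
      (k.choose c : ℝ) * (cumulantBound a b H δ (c + 1) * |∫ ω, S ω ^ (k - c) ∂P|)) :
    P.real {ω | x ≤ S ω} ≤ Real.exp (-(x ^ 2 / (2 * (H +
      δ ^ (1 / (a + b + 2)) * x ^ ((2 * a + 2 * b + 3) / (a + b + 2)))))) := by
  set B := δ ^ (1 / (a + b + 2)) * x ^ ((2 * a + 2 * b + 3) / (a + b + 2)) with hB
  have hB0 : 0 < B := by positivity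
  have hc : 0 < a + b + 2 := by linarith
  have hBpow : B ^ (a + b + 2) = δ * x ^ (2 * a + 2 * b + 3) := by
    rw [hB, Real.mul_rpow (by positivity) (by positivity), ← Real.rpow_mul hδ.le,
      ← Real.rpow_mul hx.le, div_mul_cancel₀ _ hc.ne', div_mul_cancel₀ _ hc.ne', Real.rpow_one]
  set W := H + B with hW
  have hW0 : 0 < W := by positivity
  set y := x ^ 2 / W with hy
  have hy0 : 0 < y := by positivity
  have hyW : y * W = x ^ 2 := div_mul_cancel₀ _ hW0.ne'
  set Y := x ^ 2 / B with hY
  have hY0 : 0 < Y := by positivity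
  have hYB : Y * B = x ^ 2 := div_mul_cancel₀ _ hB0.ne'
  have hyY : y ≤ Y := by
    rw [hy, hY]
    gcongr
    linarith
  have hkey : δ * x * Y ^ (a + b + 1) = B := by
    have h1 : Y ^ (a + b + 1) * B ^ (a + b + 1) = x ^ (2 * a + 2 * b + 2) := by
      rw [← Real.mul_rpow hY0.le hB0.le, hYB, ← Real.rpow_natCast, ← Real.rpow_mul hx.le]
      congr 1
      push_cast
      ring
    have h2 : B ^ (a + b + 2) = B ^ (a + b + 1) * B := by
      rw [show a + b + 2 = (a + b + 1) + 1 by ring, Real.rpow_add_one hB0.ne']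
    have h3 : x ^ (2 * a + 2 * b + 3) = x ^ (2 * a + 2 * b + 2) * x := by
      rw [show 2 * a + 2 * b + 3 = (2 * a + 2 * b + 2) + 1 by ring, Real.rpow_add_one hx.ne']
    have h4 : 0 < B ^ (a + b + 1) := by positivity
    rw [h2, h3, ← h1] at hBpow
    have : B ^ (a + b + 1) * B = B ^ (a + b + 1) * (δ * x * Y ^ (a + b + 1)) := by
      rw [hBpow]; ring
    exact (mul_left_cancel₀ h4.ne' this).symm
  have hG1 : cumulantBound a b H δ 1 = 0 := by simp [cumulantBound]
  have hG2 : cumulantBound a b H δ 2 = 3 / 4 * H := by simp [cumulantBound]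
  have hmean : ∫ ω, S ω ∂P = 0 := by
    have := hrec 0
    simpa [hG1] using this
  have hvar : ∫ ω, S ω ^ 2 ∂P ≤ 3 / 4 * H := by
    have := hrec 1
    simp [Finset.sum_range_succ, hG1, hG2] at this
    exact (le_abs_self _).trans this
  have hgoal : x ^ 2 / (2 * W) = y / 2 := by rw [hy, div_div, mul_comm W]
  rw [hgoal]
  have hcant := cantelli (by exact_mod_cast hL 2) hmean (by positivity) hvar hx
  have hviaCantelli : Real.exp (y / 2) * (3 / 4 * H) ≤ 3 / 4 * H + x ^ 2 →
      P.real {ω | x ≤ S ω} ≤ Real.exp (-(y / 2)) := by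
    intro h
    refine hcant.trans ?_
    rw [Real.exp_neg, div_le_iff₀ (by positivity), inv_mul_eq_div, le_div_iff₀ (Real.exp_pos _)]
    linarith
  rcases le_total y 3.4 with hy1 | hy1
  · refine hviaCantelli ?_
    have h1 := exp_half_le_of_le hy0.le hy1
    rw [← hyW]
    nlinarith [mul_pos hy0 hB0]
  rcases lt_or_ge Y 4.4 with hY1 | hY1
  · refine hviaCantelli ?_
    have h1 : Real.exp (y / 2) ≤ 10 := by
      refine le_of_pow_le_pow_left₀ (n := 5) (by norm_num) (by norm_num) ?_
      rw [← Real.exp_nat_mul]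
      calc Real.exp ((5 : ℕ) * (y / 2)) ≤ Real.exp ((11 : ℕ) * 1) := by
            refine Real.exp_le_exp.2 ?_
            push_cast
            norm_num at hY1
            linarith
        _ = Real.exp 1 ^ 11 := Real.exp_nat_mul _ _
        _ ≤ 2.7182818286 ^ 11 := pow_le_pow_left₀ (Real.exp_pos _).le exp_one_le _
        _ ≤ _ := by norm_num
    have h2 : Y * B < 4.4 * B := by gcongr
    have h3 : 3.4 * W ≤ y * W := by gcongr
    norm_num at h2 h3
    nlinarith
  obtain ⟨N, hN, hfac, hexp⟩ := exists_truncation hy1 hyY hY1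
  set h := x / W with hh
  have hh0 : 0 < h := by positivity
  have hhx : h * x = y := by rw [hh, hy]; ring
  set p := B / W with hp
  have hp0 : 0 < p := by positivity
  have hhY : h * δ * Y ^ (a + b + 1) = p := by
    rw [hh, hp, ← hkey]; ring
  have hhH : h ^ 2 * H = y * (1 - p) := by
    rw [hh, hy, hp]
    field_simp
    rw [hW]; ring
  have hterm : ∀ q : ℕ, q + 2 ≤ N →
      h ^ (q + 2) * cumulantBound a b H δ (q + 2) / ((q + 2)! : ℝ) ≤
        3 / 8 * y * ((1 - p) * p ^ q) := by
    intro q hq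
    have hF0 : (0 : ℝ) < ((q + 2)! : ℝ) := by positivity
    have h1 : (((q + 2)! : ℝ) / 2) ^ (a + b + 2) ≤
        ((q + 2)! : ℝ) / 2 * (Y ^ (a + b + 1)) ^ q := by
      rw [show a + b + 2 = (a + b + 1) + 1 by ring, Real.rpow_add_one (by positivity), mul_comm,
        ← Real.rpow_natCast (Y ^ (a + b + 1)), ← Real.rpow_mul hY0.le, mul_comm (a + b + 1),
        Real.rpow_mul hY0.le, Real.rpow_natCast]
      have := hfac q hq
      gcongr
    rw [cumulantBound, if_neg (by omega), Nat.add_sub_cancel]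
    calc _ ≤ h ^ (q + 2) * (3 / 4 * (((q + 2)! : ℝ) / 2 * (Y ^ (a + b + 1)) ^ q) * H * δ ^ q) /
          ((q + 2)! : ℝ) := by gcongr
      _ = 3 / 8 * (h ^ 2 * H) * (h * δ * Y ^ (a + b + 1)) ^ q := by
          rw [mul_pow, mul_pow]
          field_simp
          ring
      _ = _ := by rw [hhH, hhY]; ring
  have hsum : ∑ j ∈ Finset.range N, h ^ (j + 1) * cumulantBound a b H δ (j + 1) / ((j + 1)! : ℝ) ≤
      3 / 8 * y := by
    rcases N with _ | r
    · simp only [Finset.range_zero, Finset.sum_empty]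
      positivity
    rw [Finset.sum_range_succ', zero_add, hG1, mul_zero, zero_div, add_zero]
    calc _ ≤ ∑ q ∈ Finset.range r, 3 / 8 * y * ((1 - p) * p ^ q) :=
          Finset.sum_le_sum fun q hq => hterm q (by have := Finset.mem_range.1 hq; omega)
      _ = 3 / 8 * y * (1 - p ^ r) := by
          rw [← Finset.mul_sum, ← Finset.mul_sum, mul_neg_geom_sum]
      _ ≤ 3 / 8 * y * 1 := by
          have : 0 < p ^ r := by positivity
          gcongr
          linarith
      _ = _ := mul_one _
  have hM := measureReal_ge_le_truncExp hL hN hh0.le hx.le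
  rw [hhx] at hM
  have hM2 := hM.trans ((sum_moment_le_exp (cumulantBound a b H δ)
    (cumulantBound_nonneg hH.le hδ.le) hh0.le hrec N).trans (Real.exp_le_exp.2 hsum))
  have h1 : P.real {ω | x ≤ S ω} * Real.exp (7 / 8 * y) ≤ Real.exp (3 / 8 * y) :=
    (mul_le_mul_of_nonneg_left hexp measureReal_nonneg).trans hM2
  have h2 : Real.exp (3 / 8 * y) = Real.exp (-(y / 2)) * Real.exp (7 / 8 * y) := by
    rw [← Real.exp_add]; congr 1; ring
  rw [h2] at h1
  exact le_of_mul_le_mul_right h1 (Real.exp_pos _)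

end Tail

theorem mainTheorem3
    {Ω : Type*} [MeasurableSpace Ω] (P : Measure Ω) [IsProbabilityMeasure P]
    (n : ℕ) (hn : 1 ≤ n)
    (X : Fin n → Ω → ℝ) (hXmeas : ∀ i, Measurable (X i))
    (hXmean : ∀ i, ∫ ω, X i ω ∂P = 0)
    (τ : WeakDependenceType)
    (K M L₁ L₂ a b : ℝ) (hK : 0 < K) (hM : 0 < M) (hL₁ : 0 < L₁) (hL₂ : 0 < L₂)
    (ha : 0 ≤ a) (hb : 0 ≤ b)
    (ρ : ℕ → ℝ) (hρ : Antitone ρ)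
    (hcov : ∀ (u v : ℕ) (hu : 0 < u) (hv : 0 < v) (s : Fin u → Fin n) (t : Fin v → Fin n),
      Monotone s → Monotone t → s ⟨u - 1, Nat.sub_lt hu one_pos⟩ ≤ t ⟨0, hv⟩ →
      |cov[fun ω => ∏ i, X (s i) ω, fun ω => ∏ j, X (t j) ω; P]| ≤
        K ^ 2 * M ^ (u + v) * (((u + v)! : ℕ) : ℝ) ^ b * (τ.weight u v : ℝ) *
          ρ ((t ⟨0, hv⟩ : ℕ) - (s ⟨u - 1, Nat.sub_lt hu one_pos⟩ : ℕ)))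
    (hsum : ∀ k : ℕ, Summable (fun s : ℕ => ((s : ℝ) + 1) ^ k * ρ s) ∧
      ∑' s : ℕ, ((s : ℝ) + 1) ^ k * ρ s ≤ L₁ * L₂ ^ k * ((k ! : ℕ) : ℝ) ^ a)
    (hmom : ∀ (i : Fin n) (k : ℕ), Integrable (fun ω => |X i ω| ^ k) P ∧
      ∫ ω, |X i ω| ^ k ∂P ≤ ((k ! : ℕ) : ℝ) ^ b * M ^ k)
    (x : ℝ) (hx : 0 < x) :
    P.real {ω | x ≤ ∑ i, X i ω} ≤
      Real.exp (-(x ^ 2 /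
        (((2 : ℝ) ^ (a + b + 3) * K ^ 2 * M ^ 2 * L₁ * max (K ^ 2) 2) * (n : ℝ) +
          (2 * (M * L₂ * max (K ^ 2) 2) ^ (1 / (a + b + 2))) *
            x ^ ((2 * a + 2 * b + 3) / (a + b + 2))))) := by
  have hint : ∀ (i : Fin n) (k : ℕ), Integrable (fun ω => |X i ω| ^ k) P := fun i k => (hmom i k).1
  have hκ : 0 < max (K ^ 2) 2 := lt_max_of_lt_right two_pos
  have hn' : (0 : ℝ) < n := by exact_mod_cast hn
  have hL : ∀ p : ℕ, MemLp (fun ω => ∑ i, X i ω) p P := fun p =>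
    memLp_finsetSum _ fun i _ => memLp_of_integrable_abs_pow (hXmeas i) (hint i) p
  have h := measureReal_ge_le_of_cumulantBound hL ha hb
    (H := (2 : ℝ) ^ (a + b + 2) * K ^ 2 * M ^ 2 * L₁ * max (K ^ 2) 2 * n)
    (δ := M * L₂ * max (K ^ 2) 2) (by positivity) (by positivity) hx
    (fun k => abs_moment_succ_le hXmeas hint _ k fun B hB => by
      have : Nonempty {i // i ∈ B} := hB.to_subtype
      have h := sum_abs_cumul_le hXmeas hXmean τ K M L₁ L₂ a b hM hL₁ hL₂ ha hb ρ hρ hcov hsum hmom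
        (ι := {i // i ∈ B})
      rwa [Fintype.card_coe] at h)
  refine h.trans (le_of_eq ?_)
  congr 3
  rw [show a + b + 3 = (a + b + 2) + 1 by ring, Real.rpow_add_one two_ne_zero]
  ring
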